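/- For a prime power $q$ and an integer $k\ge 0$ put $$Q_{sym,\infty}(k)=\frac{\prod_{i=0}^\infty (1-q^{-2i-1})}{\prod_{l=1}^k (q^l-1)} .$$ (1) There is an absolute constant $\alpha_0>0$ such that for every $0<\alpha<\alpha_0$ there are constants $C',c,K>0$, depending only on $\alpha$, with the following property. Let $n\ge 0$, let $\mathbf F_q$ be a finite field, and let $F_1,\dots,F_n\subseteq[n]$ be sets such that $|F_i|<\alpha n$ for all $i$, and $i\in F_j$ if and only if $j\in F_i$. Assume that $q$ is odd, or that $i\notin F_i$ for all $i$. Then for every integer $r$ with $(1-\alpha)n\le r\le n$, the number $N$ of symmetric $n\times n$ matrices over $\mathbf F_q$ of rank $r$ whose $i$-th column has zero entries at all positions in $F_i$, for every $i$, satisfies $$\Big|N-q^{e}\,Q_{sym,\infty}(n-r)\Big|\le q^{e}\, K\Big(\frac{C'}{q}\Big)^{cn},\qquad e=\binom{n+1}{2}-\sum_{i=1}^n\big|\{j\in F_i: j\ge i\}\big| .$$ (2) In particular, let $N_0(n,q)$ be the number of invertible symmetric $n\times n$ matrices over $\mathbf F_q$ with zero diagonal, and let $S(n-1,q)$ be the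 number of all invertible symmetric $(n-1)\times(n-1)$ matrices over $\mathbf F_q$. There are absolute constants $n_0\in\mathbf N$ and $c,K>0$ such that for all odd $q$ and all $n\ge n_0$ $$\Big|N_0(n,q)-q^{\binom n2}Q_{sym,\infty}(0)\Big|\le q^{\binom n2}\,K q^{-cn} \quad\text{and}\quad \big|N_0(n,q)-S(n-1,q)\big|\le K q^{-cn}\, S(n-1,q).$$ -/

import Mathlib

noncomputable section

/-- The mass `ℙ(Q_{sym,∞} = k) = ∏_{i ≥ 0} (1 - q^{-2i-1}) / ∏_{l=1}^{k} (q^l - 1)` of the limiting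
corank distribution of symmetric matrices over a field with `q` elements. -/
def symLimitMass (q k : ℕ) : ℝ :=
  (∏' i : ℕ, (1 - ((q : ℝ) ^ (2 * i + 1))⁻¹)) / ∏ l ∈ Finset.Icc 1 k, ((q : ℝ) ^ l - 1)

/-- The infinite product in `symLimitMass` converges. -/
theorem multipliable_symLimitMass (q : ℕ) (hq : 2 ≤ q) :
    Multipliable (fun i : ℕ => (1 - ((q : ℝ) ^ (2 * i + 1))⁻¹)) := by
  have hq' : (2 : ℝ) ≤ q := by exact_mod_cast hq
  have h0 : (0 : ℝ) < q := by linarith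
  simp only [sub_eq_add_neg]
  apply Real.multipliable_one_add_of_summable
  have h : Summable (fun i : ℕ => ((q : ℝ)⁻¹) ^ i) :=
    summable_geometric_of_lt_one (by positivity) (inv_lt_one_of_one_lt₀ (by linarith))
  have h2 : Summable (fun i : ℕ => ((q : ℝ) ^ (2 * i + 1))⁻¹) := by
    refine (h.comp_injective (i := fun i : ℕ => 2 * i + 1) ?_).congr ?_
    · intro a b hab
      simp only at hab
      omega
    · intro i
      simp
  exact h2.neg

/-- A zero pattern for symmetric `n × n` matrices: sets `F i ⊆ [n]` with fewer than `α n` elements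
such that `i ∈ F j` if and only if `j ∈ F i`. -/
structure IsSymmPattern {n : ℕ} (α : ℝ) (F : Fin n → Finset (Fin n)) : Prop where
  card_lt : ∀ i, ((F i).card : ℝ) < α * n
  symm : ∀ i j, i ∈ F j ↔ j ∈ F i

/-- The number of symmetric `n × n` matrices over `𝔽` of rank `r` such that, for every `i`, the
entries of the `i`-th column with row index in `F i` vanish. -/
def symmCount (𝔽 : Type*) [Field 𝔽] {n : ℕ} (F : Fin n → Finset (Fin n)) (r : ℕ) : ℕ :=
  Nat.card {M : Matrix (Fin n) (Fin n) 𝔽 //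
    M.IsSymm ∧ (∀ i, ∀ j ∈ F i, M j i = 0) ∧ M.rank = r}

/-- The number of entries on or above the diagonal that are not forced to vanish: all
`binom (n + 1) 2` of them, less the positions `(i, j)` with `i ≤ j` and `j ∈ F i`. -/
def freeEntries {n : ℕ} (F : Fin n → Finset (Fin n)) : ℤ :=
  ((n + 1).choose 2 : ℤ) - ∑ i, (((F i).filter (fun j => i ≤ j)).card : ℤ)

end

/-! The proof is a method of moments. For `M` uniform among the symmetric matrices with the given
zero pattern, count the linearly independent `j`-tuples in `ker M`. This number is `qFalling q j (q
^ d)`, where `d` is the corank, so the means of these counts play the role of factorial moments of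
`d`.

Computing the moments. Summing over full-rank `j × n` matrices `X`, one needs the number of `M` with
`M * Xᵀ = 0`. Duality for the pairing `tr (M * Xᵀ * Z)` turns it into the number of `Z` with `Xᵀ *
Z` orthogonal to the pattern (`card_mul_transpose_eq_zero`). The map sending `Z` to `Xᵀ * Z + Zᵀ *
X` has on these `Z` a kernel of size `q ^ (j.choose 2)`; its image `gramSpace F X` consists of
symmetric matrices supported on the forbidden positions (`card_dualSolutions`). Hence the `j`-th
moment is `q ^ (j.choose 2)` times `q ^ (-j * n)` times the sum over `X` of the sizes of these
images.

Estimating them. The zero matrix contributes the proportion of full-rank `X`, which is almost 1. A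
nonzero `B` in the image forces the row space of `X` to meet the image of `B` in dimension at least
half of `rank B` (`rank_le_two_mul_finrank_comap`), which is very rare. A symmetric `B` is
determined by `rank B` of its rows, each with few allowed positions, so there are few such `B`
(`sum_pow_rank_le`). The total contribution of nonzero `B` is exponentially small.

From moments to probabilities. A `q`-analogue of the Bonferroni inequalities
(`abs_indicator_sub_truncation_le`) recovers the probability of corank `k` from finitely many
moments. With ideal moments the inversion is Euler's series at `-1/q`, and Euler's identity between
odd parts and distinct parts evaluates it as the product in `symLimitMass`.

The second claim compares two patterns with the same number `n.choose 2` of free entries and the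
same main term, which is bounded below by a positive multiple of `q ^ n.choose 2`. -/

/-! ### Truncated inversion for numbers of independent tuples -/

/-- The product `∏_{l=1}^{m} (q^l - 1)`. -/
noncomputable def qFactor (q : ℝ) (m : ℕ) : ℝ := ∏ l ∈ Finset.Icc 1 m, (q ^ l - 1)

/-- The product `∏_{i<j} (x - q^i)`, which for `x = q^d` is the number of linearly independent
`j`-tuples in a `d`-dimensional space. -/
noncomputable def qFalling (q : ℝ) (j : ℕ) (x : ℝ) : ℝ := ∏ i ∈ Finset.range j, (x - q ^ i)

theorem qFactor_zero (q : ℝ) : qFactor q 0 = 1 := by simp [qFactor]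

theorem qFactor_succ (q : ℝ) (m : ℕ) :
    qFactor q (m + 1) = qFactor q m * (q ^ (m + 1) - 1) := by
  rw [qFactor, Finset.prod_Icc_succ_top (by omega), ← qFactor]

theorem qFalling_zero (q x : ℝ) : qFalling q 0 x = 1 := by simp [qFalling]

theorem qFalling_succ (q : ℝ) (j : ℕ) (x : ℝ) :
    qFalling q (j + 1) x = qFalling q j x * (x - q ^ j) := by
  rw [qFalling, Finset.prod_range_succ, ← qFalling]

theorem qFactor_ge_one {q : ℝ} (hq : 2 ≤ q) (m : ℕ) : 1 ≤ qFactor q m := by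
  induction m with
  | zero => simp [qFactor_zero]
  | succ m ih =>
    rw [qFactor_succ]
    have : (2 : ℝ) ≤ q ^ (m + 1) := by
      calc (2 : ℝ) ≤ q := hq
        _ = q ^ 1 := (pow_one q).symm
        _ ≤ q ^ (m + 1) := pow_le_pow_right₀ (by linarith) (by omega)
    nlinarith

theorem qFactor_pos {q : ℝ} (hq : 2 ≤ q) (m : ℕ) : 0 < qFactor q m :=
  lt_of_lt_of_le one_pos (qFactor_ge_one hq m)

theorem qFalling_eq_zero {q : ℝ} {d j : ℕ} (h : d < j) : qFalling q j (q ^ d) = 0 :=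
  Finset.prod_eq_zero (Finset.mem_range.2 h) (sub_self _)

theorem qFalling_nonneg {q : ℝ} (hq : 2 ≤ q) (j d : ℕ) : 0 ≤ qFalling q j (q ^ d) := by
  rcases lt_or_ge d j with h | h
  · rw [qFalling_eq_zero h]
  · refine Finset.prod_nonneg fun i hi => sub_nonneg.2 ?_
    exact pow_le_pow_right₀ (by linarith) (by have := Finset.mem_range.1 hi; omega)

/-- Choosing `k` independent vectors and then `m` more amounts to choosing the latter modulo the
span of the former, with `q ^ k` lifts each. -/
theorem qFalling_add (q : ℝ) (k m D : ℕ) :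
    qFalling q (k + m) (q ^ (k + D)) =
      qFalling q k (q ^ (k + D)) * (q ^ (k * m) * qFalling q m (q ^ D)) := by
  induction m with
  | zero => simp [qFalling_zero]
  | succ m ih =>
    rw [← add_assoc, qFalling_succ, ih, qFalling_succ]
    ring

theorem choose_two_add (k m : ℕ) :
    (k + m).choose 2 = k.choose 2 + m.choose 2 + k * m := by
  induction m with
  | zero => simp
  | succ m ih =>
    rw [← add_assoc, Nat.choose_succ_succ' (k + m) 1, Nat.choose_succ_succ' m 1, ih]
    simp
    ring

theorem qFalling_self (q : ℝ) (j : ℕ) :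
    qFalling q j (q ^ j) = q ^ (j.choose 2) * qFactor q j := by
  induction j with
  | zero => simp [qFalling_zero, qFactor_zero]
  | succ j ih =>
    have h := qFalling_add q 1 j j
    have h1 : qFalling q 1 (q ^ (1 + j)) = q ^ (j + 1) - 1 := by
      simp [qFalling, add_comm]
    rw [h1, ih, one_mul] at h
    rw [add_comm j 1, h, add_comm 1 j, qFactor_succ, Nat.choose_succ_succ' j 1]
    simp
    ring

/-- The `q`-analogue of the closed form for a partial alternating sum of binomial coefficients,
`∑_{m ≤ L} (-1)^m C(y,m) = (-1)^L C(y-1,L)`. -/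
theorem sum_qFalling_div (q : ℝ) (hq : 2 ≤ q) (y : ℝ) (L : ℕ) :
    ∑ m ∈ Finset.range (L + 1), (-1) ^ m * (qFalling q m y / qFactor q m) =
      (-1) ^ L * ((∏ i ∈ Finset.range L, (y - q ^ (i + 1))) / qFactor q L) := by
  induction L with
  | zero => simp [qFalling_zero, qFactor_zero]
  | succ L ih =>
    rw [Finset.sum_range_succ, ih]
    have h1 : qFalling q (L + 1) y = (y - 1) * ∏ i ∈ Finset.range L, (y - q ^ (i + 1)) := by
      rw [qFalling, Finset.prod_range_succ', mul_comm]; simp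
    have h2 := qFactor_pos hq (L + 1)
    have h3 := qFactor_pos hq L
    rw [h1, Finset.prod_range_succ]
    rw [qFactor_succ] at h2 ⊢
    have h4 : q ^ (L + 1) - 1 ≠ 0 := fun h => by rw [h, mul_zero] at h2; exact lt_irrefl _ h2
    field_simp
    ring

/-- A Bonferroni inequality: the truncation error is at most the first omitted term. For `0 < D ≤ L`
the closed form vanishes; for `D > L` the omitted term is the closed form times `(q ^ D - 1) / (q ^
(L + 1) - 1) ≥ 1`. -/
theorem abs_indicator_sub_sum_le {q : ℝ} (hq : 2 ≤ q) (D L : ℕ) :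
    |(if D = 0 then 1 else 0) -
        ∑ m ∈ Finset.range (L + 1), (-1) ^ m * (qFalling q m (q ^ D) / qFactor q m)| ≤
      qFalling q (L + 1) (q ^ D) / qFactor q (L + 1) := by
  rcases Nat.eq_zero_or_pos D with rfl | hD
  · rw [Finset.sum_range_succ', Finset.sum_eq_zero]
    · simp only [if_true, qFalling_zero, qFactor_zero]
      norm_num
      exact div_nonneg (by simpa using qFalling_nonneg hq (L + 1) 0) (qFactor_pos hq _).le
    · intro i _
      rw [qFalling_eq_zero (by omega)]
      simp
  · rw [if_neg (by omega), sum_qFalling_div q hq, zero_sub, abs_neg, abs_mul, abs_pow, abs_neg,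
      abs_one, one_pow, one_mul, abs_div, abs_of_pos (qFactor_pos hq L)]
    have h1 : qFalling q (L + 1) (q ^ D) =
        (q ^ D - 1) * ∏ i ∈ Finset.range L, (q ^ D - q ^ (i + 1)) := by
      rw [qFalling, Finset.prod_range_succ', mul_comm]; simp
    rcases le_or_gt D L with h | h
    · have h2 : ∏ i ∈ Finset.range L, (q ^ D - q ^ (i + 1)) = 0 :=
        Finset.prod_eq_zero (i := D - 1) (Finset.mem_range.2 (by omega))
          (by rw [Nat.sub_add_cancel hD, sub_self])
      rw [h1, h2]; simp
    · have h2 : 0 ≤ ∏ i ∈ Finset.range L, (q ^ D - q ^ (i + 1)) :=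
        Finset.prod_nonneg fun i hi => sub_nonneg.2 <|
          pow_le_pow_right₀ (by linarith) (by have := Finset.mem_range.1 hi; omega)
      have h3 := qFactor_pos hq (L + 1)
      have h4 := qFactor_pos hq L
      rw [h1, abs_of_nonneg h2, div_le_div_iff₀ h4 h3, qFactor_succ]
      have h5 : q ^ (L + 1) ≤ q ^ D := pow_le_pow_right₀ (by linarith) h
      nlinarith [mul_nonneg h2 h4.le]

/-- Truncated inversion: the indicator of `d = k` in terms of the numbers of linearly independent
tuples in a `d`-dimensional space. -/
theorem abs_indicator_sub_truncation_le {q : ℝ} (hq : 2 ≤ q) (d k L : ℕ) :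
    |(if d = k then 1 else 0) -
        ∑ m ∈ Finset.range (L + 1), (-1) ^ m * (q ^ (m.choose 2) * qFalling q (k + m) (q ^ d) /
          (q ^ ((k + m).choose 2) * qFactor q k * qFactor q m))| ≤
      q ^ ((L + 1).choose 2) * qFalling q (k + (L + 1)) (q ^ d) /
        (q ^ ((k + (L + 1)).choose 2) * qFactor q k * qFactor q (L + 1)) := by
  have hq0 : 0 < q := by linarith
  rcases lt_or_ge d k with h | h
  · rw [qFalling_eq_zero (by omega), if_neg (by omega), Finset.sum_eq_zero]
    · simp
    · intro m _
      rw [qFalling_eq_zero (by omega)]; simp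
  · obtain ⟨D, rfl⟩ := Nat.exists_eq_add_of_le h
    -- Splitting off the first `k` vectors leaves a common nonnegative factor times the expansion
    -- for `D = d - k`, reducing the claim to the case `k = 0`.
    have key : ∀ m, q ^ (m.choose 2) * qFalling q (k + m) (q ^ (k + D)) /
          (q ^ ((k + m).choose 2) * qFactor q k * qFactor q m) =
        qFalling q k (q ^ (k + D)) / (q ^ (k.choose 2) * qFactor q k) *
          (qFalling q m (q ^ D) / qFactor q m) := by
      intro m
      have h1 := qFactor_pos hq m
      have h2 := qFactor_pos hq k
      rw [qFalling_add, choose_two_add, pow_add _ (_ + _), pow_add _ (k.choose 2)]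
      field_simp
    have hc : 0 ≤ qFalling q k (q ^ (k + D)) / (q ^ (k.choose 2) * qFactor q k) :=
      div_nonneg (qFalling_nonneg hq _ _) (mul_pos (by positivity) (qFactor_pos hq k)).le
    have hi : (if k + D = k then (1 : ℝ) else 0) =
        qFalling q k (q ^ (k + D)) / (q ^ (k.choose 2) * qFactor q k) *
          (if D = 0 then 1 else 0) := by
      rcases Nat.eq_zero_or_pos D with rfl | hD
      · have h2 := qFactor_pos hq k
        simp only [add_zero, if_true, mul_one]
        rw [qFalling_self, div_self (by positivity)]
      · rw [if_neg (by omega), if_neg (by omega), mul_zero]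
    simp only [key]
    rw [hi]
    simp only [mul_left_comm ((-1 : ℝ) ^ _)]
    rw [← Finset.mul_sum, ← mul_sub, abs_mul, abs_of_nonneg hc]
    exact mul_le_mul_of_nonneg_left (abs_indicator_sub_sum_le hq D L) hc

/-! ### Euler's series and its value at `-1/q` -/

/-- The reciprocal of `∏_{i=1}^{m} (1 - q^{-i})`. -/
noncomputable def eulerCoeff (q : ℝ) (m : ℕ) : ℝ :=
  q ^ ((m + 1).choose 2) / qFactor q m

theorem eulerCoeff_zero (q : ℝ) : eulerCoeff q 0 = 1 := by simp [eulerCoeff, qFactor_zero]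

theorem eulerCoeff_pos {q : ℝ} (hq : 2 ≤ q) (m : ℕ) : 0 < eulerCoeff q m :=
  div_pos (pow_pos (by linarith) _) (qFactor_pos hq m)

theorem eulerCoeff_succ {q : ℝ} (hq : 2 ≤ q) (m : ℕ) :
    eulerCoeff q (m + 1) * (1 - q⁻¹ ^ (m + 1)) = eulerCoeff q m := by
  have h1 := qFactor_pos hq (m + 1)
  have h2 := qFactor_pos hq m
  have h3 : q ≠ 0 := by linarith
  unfold eulerCoeff
  rw [Nat.choose_succ_succ' (m + 1) 1, Nat.choose_one_right, pow_add]
  rw [qFactor_succ] at h1 ⊢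
  have h4 : q ^ (m + 1) - 1 ≠ 0 := fun h => by rw [h, mul_zero] at h1; exact lt_irrefl _ h1
  rw [inv_pow]
  field_simp

theorem pow_choose_two_div_qFactor {q : ℝ} (hq : 2 ≤ q) (m : ℕ) :
    q ^ (m.choose 2) / qFactor q m = eulerCoeff q m * q⁻¹ ^ m := by
  have h3 : q ≠ 0 := by linarith
  unfold eulerCoeff
  rw [Nat.choose_succ_succ' m 1, Nat.choose_one_right, pow_add, inv_pow]
  field_simp

/-- The factor `1 - q⁻¹ ^ (m + 1)` strengthens the bound by 4 so that induction closes: for `q⁻¹ ≤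
1/2` one has `1 - q⁻¹ ^ (m + 1) ≤ (1 - q⁻¹ ^ (m + 2)) ^ 2`. -/
theorem eulerCoeff_succ_le {q : ℝ} (hq : 2 ≤ q) (m : ℕ) :
    eulerCoeff q (m + 1) ≤ 4 * (1 - q⁻¹ ^ (m + 1)) := by
  have hx : q⁻¹ ≤ 1 / 2 := by
    rw [inv_eq_one_div]; exact one_div_le_one_div_of_le (by norm_num) hq
  have hx0 : 0 < q⁻¹ := inv_pos.2 (by linarith)
  have hlt : ∀ m : ℕ, q⁻¹ ^ (m + 1) ≤ 1 / 2 := fun m => by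
    calc q⁻¹ ^ (m + 1) ≤ q⁻¹ ^ 1 := pow_le_pow_of_le_one hx0.le (by linarith) (by omega)
      _ ≤ 1 / 2 := by simpa using hx
  have hpos : ∀ m : ℕ, 0 < q⁻¹ ^ m := fun m => pow_pos hx0 m
  have aux : ∀ m, eulerCoeff q m ≤ 4 * (1 - q⁻¹ ^ (m + 1)) ^ 2 →
      eulerCoeff q (m + 1) ≤ 4 * (1 - q⁻¹ ^ (m + 1)) := by
    intro m h
    have h1 := hlt m
    have h2 := eulerCoeff_succ hq m
    rw [← h2] at h
    have h3 : 0 < 1 - q⁻¹ ^ (m + 1) := by linarith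
    nlinarith
  induction m with
  | zero =>
    apply aux
    rw [eulerCoeff_zero]
    have := hlt 0
    nlinarith
  | succ m ih =>
    apply aux
    refine ih.trans ?_
    have h1 : q⁻¹ ^ (m + 1 + 1) = q⁻¹ ^ (m + 1) * q⁻¹ := pow_succ _ _
    have h2 := hpos (m + 1)
    rw [h1]
    nlinarith [sq_nonneg (q⁻¹ ^ (m + 1) * q⁻¹)]

theorem eulerCoeff_le {q : ℝ} (hq : 2 ≤ q) (m : ℕ) : eulerCoeff q m ≤ 4 := by
  cases m with
  | zero => rw [eulerCoeff_zero]; norm_num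
  | succ m =>
    have h1 := eulerCoeff_succ_le hq m
    have h2 : 0 < q⁻¹ ^ (m + 1) := pow_pos (inv_pos.2 (by linarith)) _
    linarith

section Euler

variable {q : ℝ}

theorem inv_nonneg_le_half (hq : 2 ≤ q) : 0 < q⁻¹ ∧ q⁻¹ ≤ 1 / 2 :=
  ⟨inv_pos.2 (by linarith), by
    rw [inv_eq_one_div]; exact one_div_le_one_div_of_le (by norm_num) hq⟩

theorem abs_euler_term_le (hq : 2 ≤ q) (z : ℝ) (m : ℕ) :
    |eulerCoeff q m * z ^ m| ≤ 4 * |z| ^ m := by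
  rw [abs_mul, abs_of_pos (eulerCoeff_pos hq m), abs_pow]
  exact mul_le_mul_of_nonneg_right (eulerCoeff_le hq m) (by positivity)

theorem summable_euler (hq : 2 ≤ q) {z : ℝ} (hz : |z| < 1) :
    Summable fun m => eulerCoeff q m * z ^ m :=
  Summable.of_norm_bounded ((summable_geometric_of_lt_one (abs_nonneg z) hz).mul_left 4)
    fun m => by rw [Real.norm_eq_abs]; exact abs_euler_term_le hq z m

/-- The series `∑ z^m / ∏_{i=1}^{m} (1 - q^{-i})`. -/
noncomputable def eulerSeries (q z : ℝ) : ℝ := ∑' m, eulerCoeff q m * z ^ m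

/-- The recursion `eulerCoeff_succ` says that the series at `z` minus the series at `z / q` is `z`
times the series at `z`. Iterating this functional equation yields Euler's product. -/
theorem eulerSeries_mul (hq : 2 ≤ q) {z : ℝ} (hz : |z| < 1) :
    eulerSeries q z * (1 - z) = eulerSeries q (q⁻¹ * z) := by
  obtain ⟨hx0, hx⟩ := inv_nonneg_le_half hq
  have hz' : |q⁻¹ * z| < 1 := by
    rw [abs_mul, abs_of_pos hx0]; nlinarith [abs_nonneg z]
  have h1 := summable_euler hq hz
  have h2 := summable_euler hq hz'
  have h3 : eulerSeries q z - eulerSeries q (q⁻¹ * z) = z * eulerSeries q z := by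
    unfold eulerSeries
    rw [← h1.tsum_sub h2, (h1.sub h2).tsum_eq_zero_add, ← tsum_mul_left]
    simp only [pow_zero, mul_one, sub_self, zero_add]
    refine tsum_congr fun m => ?_
    rw [← eulerCoeff_succ hq m, mul_pow]
    ring
  linarith

theorem abs_eulerSeries_sub_le (hq : 2 ≤ q) {z : ℝ} (hz : |z| ≤ 1 / 2) (L : ℕ) :
    |eulerSeries q z - ∑ m ∈ Finset.range L, eulerCoeff q m * z ^ m| ≤ 8 * |z| ^ L := by
  have hz1 : |z| < 1 := by linarith
  have h1 := summable_euler hq hz1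
  have h2 := h1.sum_add_tsum_nat_add L
  have hg := (summable_geometric_of_lt_one (abs_nonneg z) hz1)
  have h3 : |∑' m, eulerCoeff q (m + L) * z ^ (m + L)| ≤ ∑' m, 4 * |z| ^ L * |z| ^ m := by
    have hs : Summable fun m => 4 * |z| ^ L * |z| ^ m := hg.mul_left _
    refine tsum_of_norm_bounded (f := fun m => eulerCoeff q (m + L) * z ^ (m + L))
      hs.hasSum fun m => ?_
    rw [Real.norm_eq_abs]
    refine (abs_euler_term_le hq z _).trans (le_of_eq ?_)
    ring
  rw [tsum_mul_left, tsum_geometric_of_lt_one (abs_nonneg z) hz1] at h3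
  have h4 : (1 - |z|)⁻¹ ≤ 2 := by
    rw [inv_le_comm₀ (by linarith) (by norm_num)]; linarith
  have h5 : 0 ≤ |z| ^ L := by positivity
  unfold eulerSeries
  rw [← h2, add_sub_cancel_left]
  nlinarith

theorem eulerSeries_neg_inv_mul_prod (hq : 2 ≤ q) (N : ℕ) :
    eulerSeries q (-q⁻¹) * ∏ i ∈ Finset.range N, (1 + q⁻¹ ^ (i + 1)) =
      eulerSeries q (-q⁻¹ ^ (N + 1)) := by
  obtain ⟨hx0, hx⟩ := inv_nonneg_le_half hq
  induction N with
  | zero => simp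
  | succ N ih =>
    have h : |(-q⁻¹ ^ (N + 1))| < 1 := by
      rw [abs_neg, abs_of_pos (pow_pos hx0 _)]
      exact pow_lt_one₀ hx0.le (by linarith) (by omega)
    rw [Finset.prod_range_succ, ← mul_assoc, ih, ← sub_neg_eq_add 1, eulerSeries_mul hq h]
    congr 1
    ring

theorem prod_odd_mul_prod_plus (x : ℝ) (N : ℕ) :
    (∏ i ∈ Finset.range N, (1 - x ^ (2 * i + 1))) * (∏ i ∈ Finset.range N, (1 + x ^ (i + 1))) *
      (∏ i ∈ Finset.range N, (1 - x ^ (i + 1))) = ∏ i ∈ Finset.range (2 * N), (1 - x ^ (i + 1)) := by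
  induction N with
  | zero => simp
  | succ N ih =>
    rw [Nat.mul_succ, Finset.prod_range_succ _ (2 * N + 1), Finset.prod_range_succ _ (2 * N), ← ih]
    simp only [Finset.prod_range_succ]
    ring

theorem one_div_four_le_prod (hq : 2 ≤ q) (N : ℕ) :
    1 / 4 ≤ ∏ i ∈ Finset.range N, (1 - q⁻¹ ^ (i + 1)) := by
  have h : eulerCoeff q N * ∏ i ∈ Finset.range N, (1 - q⁻¹ ^ (i + 1)) = 1 := by
    induction N with
    | zero => simp [eulerCoeff_zero]
    | succ N ih => rw [Finset.prod_range_succ, mul_comm (∏ _ ∈ _, _), ← mul_assoc,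
        eulerCoeff_succ hq, ih]
  have h1 := eulerCoeff_le hq N
  have h2 := eulerCoeff_pos hq N
  have h3 : 0 < ∏ i ∈ Finset.range N, (1 - q⁻¹ ^ (i + 1)) := by
    by_contra hc
    nlinarith
  nlinarith

/-- Euler's identity (odd parts versus distinct parts): the partial product equals `D (2 * N) / D N`
for the partial products `D` of `1 - q⁻¹ ^ (i + 1)`, and `D` decreases to a limit that is at least
1/4. -/
theorem tendsto_prod_odd_mul_prod_plus (hq : 2 ≤ q) :
    Filter.Tendsto (fun N => (∏ i ∈ Finset.range N, (1 - q⁻¹ ^ (2 * i + 1))) *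
      (∏ i ∈ Finset.range N, (1 + q⁻¹ ^ (i + 1)))) Filter.atTop (nhds 1) := by
  obtain ⟨hx0, hx⟩ := inv_nonneg_le_half hq
  set D : ℕ → ℝ := fun N => ∏ i ∈ Finset.range N, (1 - q⁻¹ ^ (i + 1)) with hD
  have hlow : ∀ N, 1 / 4 ≤ D N := one_div_four_le_prod hq
  have hanti : Antitone D := antitone_nat_of_succ_le fun N => by
    have h1 : 0 < q⁻¹ ^ (N + 1) := pow_pos hx0 _
    have h2 := hlow N
    simp only [hD, Finset.prod_range_succ] at h2 ⊢
    nlinarith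
  have hlim := tendsto_atTop_ciInf hanti ⟨1 / 4, by rintro _ ⟨N, rfl⟩; exact hlow N⟩
  have hne : (⨅ i, D i) ≠ 0 := by
    have := ge_of_tendsto' hlim hlow
    intro h; rw [h] at this; norm_num at this
  have h2 : Filter.Tendsto (fun N : ℕ => 2 * N) Filter.atTop Filter.atTop :=
    Filter.tendsto_id.const_mul_atTop' (by norm_num)
  have h3 := (hlim.comp h2).div hlim hne
  rw [div_self hne] at h3
  refine h3.congr fun N => ?_
  have h4 : D N ≠ 0 := by have := hlow N; intro h; rw [h] at this; norm_num at this
  simp only [Function.comp, Pi.div_apply]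
  rw [div_eq_iff h4]
  exact (prod_odd_mul_prod_plus q⁻¹ N).symm

theorem eulerSeries_neg_inv {q : ℕ} (hq : 2 ≤ q) :
    eulerSeries q (-(q : ℝ)⁻¹) = ∏' i : ℕ, (1 - ((q : ℝ) ^ (2 * i + 1))⁻¹) := by
  have hq' : (2 : ℝ) ≤ q := by exact_mod_cast hq
  obtain ⟨hx0, hx⟩ := inv_nonneg_le_half hq'
  have h1 := (multipliable_symLimitMass q hq).tendsto_prod_tprod_nat
  have h2 := tendsto_prod_odd_mul_prod_plus hq'
  have h3 : Filter.Tendsto (fun N => eulerSeries q (-(q : ℝ)⁻¹ ^ (N + 1)))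
      Filter.atTop (nhds 1) := by
    have h4 : Filter.Tendsto (fun N : ℕ => 8 * (q : ℝ)⁻¹ ^ (N + 1)) Filter.atTop (nhds 0) := by
      have := ((Filter.tendsto_add_atTop_iff_nat 1).2
        (tendsto_pow_atTop_nhds_zero_of_lt_one hx0.le (by linarith))).const_mul (8 : ℝ)
      simpa using this
    rw [tendsto_iff_dist_tendsto_zero]
    refine squeeze_zero (fun _ => dist_nonneg) (fun N => ?_) h4
    have hle : (q : ℝ)⁻¹ ^ (N + 1) ≤ 1 / 2 := by
      calc (q : ℝ)⁻¹ ^ (N + 1) ≤ (q : ℝ)⁻¹ ^ 1 :=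
            pow_le_pow_of_le_one hx0.le (by linarith) (by omega)
        _ ≤ 1 / 2 := by simpa using hx
    have habs : |(-(q : ℝ)⁻¹ ^ (N + 1))| = (q : ℝ)⁻¹ ^ (N + 1) := by
      rw [abs_neg, abs_of_pos (pow_pos hx0 _)]
    have := abs_eulerSeries_sub_le hq' (z := -(q : ℝ)⁻¹ ^ (N + 1)) (habs.le.trans hle) 1
    rw [habs] at this
    simpa [eulerCoeff_zero, Real.dist_eq] using this
  have h5 : Filter.Tendsto (fun N => (∏ i ∈ Finset.range N, (1 - ((q : ℝ) ^ (2 * i + 1))⁻¹)) *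
      eulerSeries q (-(q : ℝ)⁻¹ ^ (N + 1))) Filter.atTop (nhds (eulerSeries q (-(q : ℝ)⁻¹))) := by
    have h6 := h2.const_mul (eulerSeries q (-(q : ℝ)⁻¹))
    rw [mul_one] at h6
    refine h6.congr fun N => ?_
    rw [← eulerSeries_neg_inv_mul_prod hq']
    simp only [inv_pow]
    ring
  have h7 := tendsto_nhds_unique h5 (h1.mul h3)
  rw [h7, mul_one]

end Euler

/-! ### From moments to the distribution of the corank -/

/-- If the mean numbers of linearly independent `j`-tuples in spaces of random dimension `d ω` are
close to the values for kernels of symmetric matrices, then the distribution of the dimension is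
close to `symLimitMass`. -/
theorem abs_card_div_sub_symLimitMass_le {Ω : Type*} [Fintype Ω] [Nonempty Ω] (d : Ω → ℕ)
    {q : ℕ} (hq : 2 ≤ q) (k L : ℕ) (g : ℕ → ℝ) {ε : ℝ}
    (hg : ∀ j ≤ k + (L + 1), ∑ ω, qFalling q j ((q : ℝ) ^ d ω) =
      Fintype.card Ω * ((q : ℝ) ^ (j.choose 2) * g j))
    (hε : ∀ j ≤ k + (L + 1), |g j - 1| ≤ ε) :
    |(Nat.card {ω // d ω = k} : ℝ) / Fintype.card Ω - symLimitMass q k| ≤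
      8 * ε + 4 * (1 + ε) * (q : ℝ)⁻¹ ^ (L + 1) + 8 * (q : ℝ)⁻¹ ^ (L + 1) := by
  have hq' : (2 : ℝ) ≤ q := by exact_mod_cast hq
  obtain ⟨hx0, hx⟩ := inv_nonneg_le_half hq'
  have hε0 : 0 ≤ ε := (abs_nonneg _).trans (hε 0 (Nat.zero_le _))
  have hφ := qFactor_ge_one hq' k
  have hΩ : (0 : ℝ) < Fintype.card Ω := by exact_mod_cast Fintype.card_pos
  have hcard : (Nat.card {ω // d ω = k} : ℝ) = ∑ ω, (if d ω = k then (1 : ℝ) else 0) := by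
    classical
    rw [Nat.card_eq_fintype_card, Fintype.card_subtype]
    simp
  have hmain := Finset.abs_sum_le_sum_abs (fun ω => (if d ω = k then (1 : ℝ) else 0) -
        ∑ m ∈ Finset.range (L + 1), (-1) ^ m * ((q : ℝ) ^ (m.choose 2) *
          qFalling q (k + m) ((q : ℝ) ^ d ω) /
          ((q : ℝ) ^ ((k + m).choose 2) * qFactor q k * qFactor q m))) Finset.univ
  have hterm : ∀ m ≤ L + 1, ∑ ω, (q : ℝ) ^ (m.choose 2) *
          qFalling q (k + m) ((q : ℝ) ^ d ω) /
          ((q : ℝ) ^ ((k + m).choose 2) * qFactor q k * qFactor q m) =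
        Fintype.card Ω * (eulerCoeff q m * (q : ℝ)⁻¹ ^ m * g (k + m) / qFactor q k) := by
    intro m hm
    have h1 := qFactor_pos hq' m
    have h2 := qFactor_pos hq' k
    rw [← Finset.sum_div, ← Finset.mul_sum, hg _ (by omega), ← pow_choose_two_div_qFactor hq']
    field_simp
  have hbd := hmain.trans (Finset.sum_le_sum fun ω _ =>
    abs_indicator_sub_truncation_le hq' (d ω) k L)
  rw [hterm _ le_rfl, Finset.sum_sub_distrib, ← hcard, Finset.sum_comm] at hbd
  simp only [← Finset.mul_sum] at hbd
  rw [Finset.sum_congr rfl fun m hm => by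
    rw [hterm m (by have := Finset.mem_range.1 hm; omega)]] at hbd
  simp only [mul_left_comm _ (Fintype.card Ω : ℝ)] at hbd
  rw [← Finset.mul_sum] at hbd
  -- `T` is the truncated inversion with the actual moments and `R` bounds its error; `T'` below,
  -- divided by `qFactor q k`, is the same sum with every `g` replaced by 1, a partial sum of
  -- Euler's series.
  set T := ∑ m ∈ Finset.range (L + 1),
    (-1) ^ m * (eulerCoeff q m * (q : ℝ)⁻¹ ^ m * g (k + m) / qFactor q k) with hT
  set R := eulerCoeff q (L + 1) * (q : ℝ)⁻¹ ^ (L + 1) * g (k + (L + 1)) / qFactor q k with hR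
  have h1 : |(Nat.card {ω // d ω = k} : ℝ) / Fintype.card Ω - T| ≤ R := by
    rw [div_sub' hΩ.ne', abs_div, abs_of_pos hΩ, div_le_iff₀ hΩ]
    linarith
  have hpow : 0 < (q : ℝ)⁻¹ ^ (L + 1) := pow_pos hx0 _
  have h2 : R ≤ 4 * (1 + ε) * (q : ℝ)⁻¹ ^ (L + 1) := by
    have ha := eulerCoeff_le hq' (L + 1)
    have ha0 := eulerCoeff_pos hq' (L + 1)
    have hgb : g (k + (L + 1)) ≤ 1 + ε := by
      have := (abs_le.1 (hε _ le_rfl)).2; linarith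
    rw [hR, div_le_iff₀ (by linarith)]
    have h3 : eulerCoeff q (L + 1) * (q : ℝ)⁻¹ ^ (L + 1) * g (k + (L + 1)) ≤
        eulerCoeff q (L + 1) * (q : ℝ)⁻¹ ^ (L + 1) * (1 + ε) :=
      mul_le_mul_of_nonneg_left hgb (by positivity)
    have h4 : eulerCoeff q (L + 1) * (q : ℝ)⁻¹ ^ (L + 1) * (1 + ε) ≤
        4 * (q : ℝ)⁻¹ ^ (L + 1) * (1 + ε) := by gcongr
    have h5 : 4 * (1 + ε) * (q : ℝ)⁻¹ ^ (L + 1) * 1 ≤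
        4 * (1 + ε) * (q : ℝ)⁻¹ ^ (L + 1) * qFactor q k := by gcongr
    linarith
  set T' := ∑ m ∈ Finset.range (L + 1), eulerCoeff q m * (-(q : ℝ)⁻¹) ^ m with hT'
  have h3 : |T - T' / qFactor q k| ≤ 8 * ε := by
    rw [hT, hT', Finset.sum_div, ← Finset.sum_sub_distrib]
    refine (Finset.abs_sum_le_sum_abs _ _).trans ?_
    -- The geometric majorant sums to `8 * ε`.
    have : ∀ m ∈ Finset.range (L + 1),
        |(-1) ^ m * (eulerCoeff q m * (q : ℝ)⁻¹ ^ m * g (k + m) / qFactor q k) -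
          eulerCoeff q m * (-(q : ℝ)⁻¹) ^ m / qFactor q k| ≤ 4 * ε * (1 / 2) ^ m := by
      intro m hm
      have e1 : (-1) ^ m * (eulerCoeff q m * (q : ℝ)⁻¹ ^ m * g (k + m) / qFactor q k) -
          eulerCoeff q m * (-(q : ℝ)⁻¹) ^ m / qFactor q k =
          (eulerCoeff q m * (-(q : ℝ)⁻¹) ^ m) * (g (k + m) - 1) / qFactor q k := by
        rw [neg_pow (q : ℝ)⁻¹]; ring
      rw [e1, abs_div, abs_mul, abs_of_pos (qFactor_pos hq' k)]
      refine (div_le_self (by positivity) hφ).trans ?_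
      have e2 := abs_euler_term_le hq' (-(q : ℝ)⁻¹) m
      rw [abs_neg, abs_of_pos hx0] at e2
      have e3 : (q : ℝ)⁻¹ ^ m ≤ (1 / 2) ^ m := by gcongr
      have e4 := hε (k + m) (by have := Finset.mem_range.1 hm; omega)
      calc _ ≤ (4 * (1 / 2) ^ m) * ε := by gcongr; linarith
        _ = _ := by ring
    refine (Finset.sum_le_sum this).trans ?_
    rw [← Finset.mul_sum]
    have := Summable.sum_le_tsum (Finset.range (L + 1)) (fun i _ => by positivity)
      summable_geometric_two
    rw [tsum_geometric_two] at this
    nlinarith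
  have h4 : |T' / qFactor q k - symLimitMass q k| ≤ 8 * (q : ℝ)⁻¹ ^ (L + 1) := by
    have h := abs_eulerSeries_sub_le hq' (z := -(q : ℝ)⁻¹)
      (by rw [abs_neg, abs_of_pos hx0]; exact hx) (L + 1)
    rw [abs_neg, abs_of_pos hx0, eulerSeries_neg_inv hq, abs_sub_comm] at h
    have e : symLimitMass q k = (∏' i : ℕ, (1 - ((q : ℝ) ^ (2 * i + 1))⁻¹)) / qFactor q k := rfl
    rw [e, ← sub_div, abs_div, abs_of_pos (qFactor_pos hq' k)]
    exact (div_le_self (abs_nonneg _) hφ).trans h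
  have h5 := abs_sub_le ((Nat.card {ω // d ω = k} : ℝ) / Fintype.card Ω) T (T' / qFactor q k)
  have h6 := abs_sub_le ((Nat.card {ω // d ω = k} : ℝ) / Fintype.card Ω) (T' / qFactor q k)
    (symLimitMass q k)
  linarith

/-! ### Trace duality for matrices with a zero pattern -/

section Linear

open Matrix Module

variable {𝔽 : Type*} [Field 𝔽]

/-- The left and right kernels of a bilinear pairing of finite spaces. -/
theorem card_ker_mul_card {V W : Type*} [AddCommGroup V] [Module 𝔽 V] [AddCommGroup W]
    [Module 𝔽 W] [Finite V] [Finite W] (β : V →ₗ[𝔽] W →ₗ[𝔽] 𝔽) :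
    Nat.card (LinearMap.ker β) * Nat.card W = Nat.card V * Nat.card (LinearMap.ker β.flip) := by
  have : FiniteDimensional 𝔽 V := Module.Finite.of_finite
  have : FiniteDimensional 𝔽 W := Module.Finite.of_finite
  have h1 : finrank 𝔽 (LinearMap.ker β) + finrank 𝔽 (LinearMap.range β.flip) = finrank 𝔽 V := by
    rw [← LinearMap.dualAnnihilator_ker_eq_range_flip]
    exact Subspace.finrank_add_finrank_dualAnnihilator_eq _
  have h2 := LinearMap.finrank_range_add_finrank_ker β.flip
  rw [Module.natCard_eq_pow_finrank (K := 𝔽) (V := LinearMap.ker β),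
    Module.natCard_eq_pow_finrank (K := 𝔽) (V := W),
    Module.natCard_eq_pow_finrank (K := 𝔽) (V := V),
    Module.natCard_eq_pow_finrank (K := 𝔽) (V := LinearMap.ker β.flip), ← pow_add, ← pow_add]
  congr 1
  omega

theorem card_comap_mul_card {V W : Type*} [AddCommGroup V] [Module 𝔽 V] [AddCommGroup W]
    [Module 𝔽 W] [Finite V] [Finite W] (f : V →ₗ[𝔽] W) (hf : Function.Surjective f)
    (S : Submodule 𝔽 W) :
    Nat.card (S.comap f) * Nat.card W = Nat.card V * Nat.card S := by
  have h := AddSubgroup.index_comap_of_surjective S.toAddSubgroup (f := f.toAddMonoidHom) hf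
  have h1 := (S.toAddSubgroup.comap f.toAddMonoidHom).card_mul_index
  have h2 := S.toAddSubgroup.card_mul_index
  rw [h] at h1
  change Nat.card (S.comap f) * _ = _ at h1
  change Nat.card S * _ = _ at h2
  rw [← h1, ← h2]
  ring

theorem natCard_matrix (𝔽 : Type*) [Fintype 𝔽] (j n : ℕ) :
    Nat.card (Matrix (Fin j) (Fin n) 𝔽) = Fintype.card 𝔽 ^ (j * n) := by
  unfold Matrix
  rw [Nat.card_fun, Nat.card_fun, Nat.card_eq_fintype_card, Nat.card_fin, Nat.card_fin, ← pow_mul,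
    mul_comm]

variable {n j : ℕ}

/-- The space of symmetric matrices with zero pattern `F`. -/
def symmPattern (𝔽 : Type*) [Field 𝔽] (F : Fin n → Finset (Fin n)) :
    Submodule 𝔽 (Matrix (Fin n) (Fin n) 𝔽) where
  carrier := {M | M.IsSymm ∧ ∀ i, ∀ j ∈ F i, M j i = 0}
  add_mem' := fun {A B} hA hB => ⟨hA.1.add hB.1, fun i j hj => by
    rw [Matrix.add_apply, hA.2 i j hj, hB.2 i j hj, add_zero]⟩
  zero_mem' := ⟨Matrix.isSymm_zero, fun _ _ _ => rfl⟩
  smul_mem' := fun c A hA => ⟨hA.1.smul c, fun i j hj => by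
    rw [Matrix.smul_apply, hA.2 i j hj, smul_zero]⟩

/-- The positions on or above the diagonal that are not forced to vanish. -/
def freePositions (F : Fin n → Finset (Fin n)) : Finset (Fin n × Fin n) :=
  Finset.univ.filter fun p => p.1 ≤ p.2 ∧ p.2 ∉ F p.1

theorem card_freePositions (F : Fin n → Finset (Fin n)) :
    ((freePositions F).card : ℤ) = freeEntries F := by
  classical
  have h1 : ((Finset.univ : Finset (Fin n × Fin n)).filter fun p => p.1 ≤ p.2).card =
      (n + 1).choose 2 := by
    have : ((Finset.univ : Finset (Fin n × Fin n)).filter fun p => p.1 ≤ p.2).card =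
        ∑ i : Fin n, (Finset.Ici i).card := by
      rw [← Finset.card_sigma]
      refine Finset.card_bij' (fun p _ => ⟨p.1, p.2⟩) (fun s _ => (s.1, s.2)) ?_ ?_ ?_ ?_ <;> simp
    rw [this]
    simp only [Fin.card_Ici]
    have h := Fin.sum_univ_eq_sum_range (fun i => n - i) n
    rw [h, ← Finset.sum_range_reflect]
    have h2 : ∑ i ∈ Finset.range n, (n - (n - 1 - i)) = ∑ i ∈ Finset.range n, (i + 1) :=
      Finset.sum_congr rfl fun i hi => by have := Finset.mem_range.1 hi; omega
    rw [h2]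
    have h3 := Finset.sum_range_succ' (fun i => i) n
    rw [add_zero, Finset.sum_range_id] at h3
    rw [← h3, Nat.choose_two_right]
  have h2 : ((Finset.univ : Finset (Fin n × Fin n)).filter fun p => p.1 ≤ p.2 ∧ p.2 ∈ F p.1).card =
      ∑ i, ((F i).filter (fun j => i ≤ j)).card := by
    rw [← Finset.card_sigma]
    refine Finset.card_bij' (fun p _ => ⟨p.1, p.2⟩) (fun s _ => (s.1, s.2)) ?_ ?_ ?_ ?_ <;>
      simp +contextual
  have h3 := Finset.card_filter_add_card_filter_not
    (s := (Finset.univ : Finset (Fin n × Fin n)).filter fun p => p.1 ≤ p.2)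
    (fun p => p.2 ∈ F p.1)
  rw [Finset.filter_filter, Finset.filter_filter, h1, h2] at h3
  unfold freeEntries freePositions
  rw [← h3]
  push_cast
  ring

theorem card_symmPattern [Fintype 𝔽] {F : Fin n → Finset (Fin n)} (hF : ∀ i j, i ∈ F j ↔ j ∈ F i) :
    Nat.card (symmPattern 𝔽 F) = Fintype.card 𝔽 ^ (freePositions F).card := by
  have e : symmPattern 𝔽 F ≃ (freePositions F → 𝔽) :=
    { toFun := fun M p => M.1 p.1.1 p.1.2
      invFun := fun f => ⟨Matrix.of fun a b =>
          if h : (min a b, max a b) ∈ freePositions F then f ⟨_, h⟩ else 0, by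
        refine ⟨?_, ?_⟩
        · ext a b
          simp only [Matrix.transpose_apply, Matrix.of_apply, min_comm b a, max_comm b a]
        · intro i j hj
          rw [Matrix.of_apply, dif_neg]
          intro h
          have h := (Finset.mem_filter.1 h).2.2
          rcases le_total i j with hij | hij
          · simp only [min_eq_right hij, max_eq_left hij] at h
            exact h hj
          · simp only [min_eq_left hij, max_eq_right hij] at h
            exact h ((hF _ _).1 hj)⟩
      left_inv := by
        rintro ⟨M, hM⟩
        ext a b
        simp only [Matrix.of_apply]
        split_ifs with h
        · rcases le_total a b with hab | hab
          · simp [min_eq_left hab, max_eq_right hab]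
          · simp only [min_eq_right hab, max_eq_left hab]
            exact hM.1.apply a b
        · have h : ¬ (max a b) ∉ F (min a b) := fun h' =>
            h (Finset.mem_filter.2 ⟨Finset.mem_univ _, min_le_max, h'⟩)
          rw [not_not] at h
          rcases le_total a b with hab | hab
          · simp only [min_eq_left hab, max_eq_right hab] at h
            exact (hM.2 b a ((hF _ _).1 h)).symm
          · simp only [min_eq_right hab, max_eq_left hab] at h
            exact (hM.2 b a h).symm
      right_inv := by
        intro f
        ext ⟨⟨a, b⟩, h⟩
        have hab : a ≤ b := (Finset.mem_filter.1 h).2.1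
        simp [min_eq_left hab, max_eq_right hab, h] }
  rw [Nat.card_congr e, Nat.card_eq_fintype_card, Fintype.card_fun, Fintype.card_coe]

/-- Orthogonality to `symmPattern` under the trace pairing. -/
def IsPatternDual (F : Fin n → Finset (Fin n)) (C : Matrix (Fin n) (Fin n) 𝔽) : Prop :=
  (∀ a b, a ≠ b → b ∉ F a → C a b + C b a = 0) ∧ ∀ a, a ∉ F a → C a a = 0

/-- Test matrices supported on one free position and its mirror image give one direction; for the
other, the terms of the trace at `(a, b)` and `(b, a)` cancel. Off-diagonal and diagonal conditions
are kept separate so that characteristic 2 is covered. -/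
theorem forall_trace_mul_eq_zero_iff {F : Fin n → Finset (Fin n)}
    (hF : ∀ i j, i ∈ F j ↔ j ∈ F i) (C : Matrix (Fin n) (Fin n) 𝔽) :
    (∀ M ∈ symmPattern 𝔽 F, trace (M * C) = 0) ↔ IsPatternDual F C := by
  constructor
  · intro h
    refine ⟨fun a b hab hb => ?_, fun a ha => ?_⟩
    · have := h (single a b 1 + single b a 1) ⟨?_, ?_⟩
      · rw [add_mul, trace_add, trace_single_mul, trace_single_mul, one_smul, one_smul] at this
        rw [add_comm]; exact this
      · unfold Matrix.IsSymm
        rw [transpose_add, transpose_single, transpose_single, add_comm]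
      · intro i j hj
        rw [Matrix.add_apply, single_apply_of_ne, single_apply_of_ne, add_zero]
        · rintro ⟨rfl, rfl⟩; exact hb hj
        · rintro ⟨rfl, rfl⟩; exact hb ((hF _ _).1 hj)
    · have := h (single a a 1) ⟨?_, ?_⟩
      · rwa [trace_single_mul, one_smul] at this
      · exact transpose_single _ _ _
      · intro i j hj
        rw [single_apply_of_ne]
        rintro ⟨rfl, rfl⟩; exact ha hj
  · rintro ⟨h1, h2⟩ M ⟨hM1, hM2⟩
    simp only [trace, diag_apply, mul_apply]
    rw [← Finset.sum_product']
    refine Finset.sum_ninvolution (fun p => (p.2, p.1)) ?_ ?_ (by simp) (by simp)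
    · rintro ⟨a, b⟩
      simp only
      rw [hM1.apply a b]
      by_cases hb : b ∈ F a
      · rw [← hM1.apply a b, hM2 a b hb]; simp
      · by_cases hab : a = b
        · subst hab
          rw [h2 a hb]; simp
        · rw [← mul_add, add_comm, h1 a b hab hb, mul_zero]
    · rintro ⟨a, b⟩ h hab
      simp only [Prod.mk.injEq] at hab h
      obtain ⟨rfl, -⟩ := hab
      apply h
      by_cases hb : b ∈ F b
      · rw [hM2 b b hb, zero_mul]
      · rw [h2 b hb, mul_zero]

/-- The two sets are the left and right kernels of the pairing `tr (M * Xᵀ * Z)`. -/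
theorem card_mul_transpose_eq_zero [Fintype 𝔽] {F : Fin n → Finset (Fin n)}
    (hF : ∀ i j, i ∈ F j ↔ j ∈ F i) (X : Matrix (Fin j) (Fin n) 𝔽) :
    Nat.card {M : symmPattern 𝔽 F // M.1 * Xᵀ = 0} * Fintype.card 𝔽 ^ (j * n) =
      Nat.card (symmPattern 𝔽 F) *
        Nat.card {Z : Matrix (Fin j) (Fin n) 𝔽 // IsPatternDual F (Xᵀ * Z)} := by
  let β : symmPattern 𝔽 F →ₗ[𝔽] Matrix (Fin j) (Fin n) 𝔽 →ₗ[𝔽] 𝔽 :=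
    LinearMap.mk₂ 𝔽 (fun M Z => trace (M.1 * (Xᵀ * Z)))
      (fun M M' Z => by rw [Submodule.coe_add, add_mul, trace_add])
      (fun c M Z => by rw [Submodule.coe_smul, smul_mul, trace_smul])
      (fun M Z Z' => by rw [Matrix.mul_add, Matrix.mul_add, trace_add])
      (fun c M Z => by rw [Matrix.mul_smul, Matrix.mul_smul, trace_smul])
  have h := card_ker_mul_card β
  have h1 : Nat.card (Matrix (Fin j) (Fin n) 𝔽) = Fintype.card 𝔽 ^ (j * n) := by
    exact natCard_matrix 𝔽 j n
  have h2 : Nat.card (LinearMap.ker β) = Nat.card {M : symmPattern 𝔽 F // M.1 * Xᵀ = 0} := by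
    refine Nat.card_congr (Equiv.subtypeEquivRight fun M => ?_)
    rw [LinearMap.mem_ker, LinearMap.ext_iff, ext_iff_trace_mul_right]
    simp [β, Matrix.mul_assoc]
  have h3 : Nat.card (LinearMap.ker β.flip) =
      Nat.card {Z : Matrix (Fin j) (Fin n) 𝔽 // IsPatternDual F (Xᵀ * Z)} := by
    refine Nat.card_congr (Equiv.subtypeEquivRight fun Z => ?_)
    rw [LinearMap.mem_ker, LinearMap.ext_iff, ← forall_trace_mul_eq_zero_iff hF]
    simp [β]
  rw [h1, h2, h3] at h
  exact h

end Linear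

/-! ### Solutions of the dual problem and exact moments -/

section Gram

open Matrix Module

variable {𝔽 : Type*} [Field 𝔽] {n j : ℕ}

/-- For the empty pattern `IsPatternDual` means alternating. The duality count with `X = 1`, where
only `M = 0` survives, gives exponent `j * j - (j + 1).choose 2`. -/
theorem card_alternating [Fintype 𝔽] (j : ℕ) :
    Nat.card {A : Matrix (Fin j) (Fin j) 𝔽 // IsPatternDual (fun _ => ∅) A} =
      Fintype.card 𝔽 ^ (j.choose 2) := by
  have hF : ∀ a b : Fin j, a ∈ (fun _ => ∅ : Fin j → Finset (Fin j)) b ↔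
      b ∈ (fun _ => ∅ : Fin j → Finset (Fin j)) a := by simp
  have h := card_mul_transpose_eq_zero hF (1 : Matrix (Fin j) (Fin j) 𝔽)
  have h1 : Nat.card {M : symmPattern 𝔽 (fun _ : Fin j => ∅) //
      M.1 * (1 : Matrix (Fin j) (Fin j) 𝔽)ᵀ = 0} = 1 := by
    rw [Nat.card_eq_one_iff_unique]
    refine ⟨⟨?_⟩, ⟨⟨0, by simp⟩⟩⟩
    rintro ⟨a, ha⟩ ⟨b, hb⟩
    rw [transpose_one, Matrix.mul_one] at ha hb
    exact Subtype.ext (Subtype.ext (ha.trans hb.symm))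
  have h2 : (freePositions (fun _ : Fin j => ∅)).card = (j + 1).choose 2 := by
    have := card_freePositions (fun _ : Fin j => ∅)
    simp only [freeEntries, Finset.filter_empty, Finset.card_empty, Nat.cast_zero,
      Finset.sum_const_zero, sub_zero] at this
    exact_mod_cast this
  have h3 : j * j = (j + 1).choose 2 + j.choose 2 := by
    rw [Nat.choose_succ_succ' j 1, Nat.choose_one_right]
    rw [Nat.choose_two_right]
    have h5 : j * (j - 1) / 2 * 2 = j * (j - 1) :=
      Nat.div_mul_cancel (Nat.even_mul_pred_self j).two_dvd
    cases j with
    | zero => simp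
    | succ j => simp only [Nat.add_sub_cancel] at h5 ⊢; nlinarith
  rw [h1, one_mul, card_symmPattern hF, h2, h3, pow_add] at h
  simp only [transpose_one, Matrix.one_mul] at h
  exact (Nat.eq_of_mul_eq_mul_left (pow_pos Fintype.card_pos _) h).symm

/-- Congruence by `N` is adjoint, under the trace pairing, to the map taking symmetric `M` to the
symmetric matrix `N * M * Nᵀ`. -/
theorem IsPatternDual.congruence {m : ℕ} {A : Matrix (Fin m) (Fin m) 𝔽}
    (hA : IsPatternDual (fun _ => ∅) A) (N : Matrix (Fin m) (Fin n) 𝔽) :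
    IsPatternDual (fun _ => ∅) (Nᵀ * A * N) := by
  rw [← forall_trace_mul_eq_zero_iff (by simp)] at hA ⊢
  intro M hM
  have := hA (N * M * Nᵀ) ⟨?_, by simp⟩
  · rw [← this, ← Matrix.mul_assoc, trace_mul_comm]
    simp only [Matrix.mul_assoc]
  · unfold Matrix.IsSymm
    rw [transpose_mul, transpose_mul, transpose_transpose, hM.1.eq, Matrix.mul_assoc]

theorem IsPatternDual.eq_neg_transpose {C : Matrix (Fin n) (Fin n) 𝔽}
    (hC : IsPatternDual (fun _ => ∅) C) : C = -Cᵀ := by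
  ext a b
  rw [Matrix.neg_apply, transpose_apply]
  by_cases hab : a = b
  · subst hab
    rw [hC.2 a (by simp), neg_zero]
  · exact eq_neg_of_add_eq_zero_left (hC.1 a b hab (by simp))

/-- Antisymmetry of `Xᵀ * Z` puts the rows of `Z` in the row space of `X`, so `Z = A * X` with `A =
Z * Y`, and `A` is alternating exactly when `Xᵀ * Z` is. -/
theorem card_alternating_lifts [Fintype 𝔽] {X : Matrix (Fin j) (Fin n) 𝔽}
    {Y : Matrix (Fin n) (Fin j) 𝔽} (hXY : X * Y = 1) :
    Nat.card {Z : Matrix (Fin j) (Fin n) 𝔽 // IsPatternDual (fun _ => ∅) (Xᵀ * Z)} =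
      Fintype.card 𝔽 ^ (j.choose 2) := by
  rw [← card_alternating (𝔽 := 𝔽) j]
  have hYX : Yᵀ * Xᵀ = 1 := by rw [← transpose_mul, hXY, transpose_one]
  refine Nat.card_congr
    { toFun := fun Z => ⟨Z.1 * Y, by
        have := Z.2.congruence Y
        rwa [← Matrix.mul_assoc Yᵀ, hYX, Matrix.one_mul] at this⟩
      invFun := fun A => ⟨A.1 * X, by
        have := A.2.congruence X
        rwa [Matrix.mul_assoc] at this⟩
      left_inv := ?_
      right_inv := ?_ }
  · rintro ⟨Z, hZ⟩
    have h1 : Z = -(Yᵀ * Zᵀ) * X := by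
      have h2 := congrArg (fun C => Yᵀ * C) hZ.eq_neg_transpose
      simp only [transpose_mul, transpose_transpose, Matrix.mul_neg] at h2
      rw [← Matrix.mul_assoc, hYX, Matrix.one_mul] at h2
      rw [Matrix.neg_mul, Matrix.mul_assoc]
      exact h2
    refine Subtype.ext ?_
    change Z * Y * X = Z
    have h3 : Z * Y * X = -(Yᵀ * Zᵀ) * X := by
      conv_lhs => rw [h1]
      rw [Matrix.mul_assoc _ X Y, hXY, Matrix.mul_one]
    rw [h3, ← h1]
  · rintro ⟨A, hA⟩
    refine Subtype.ext ?_
    change A * X * Y = A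
    rw [Matrix.mul_assoc, hXY, Matrix.mul_one]

/-- The matrices `Z` for which `Xᵀ * Z` is orthogonal to the pattern. -/
def dualSolutions (F : Fin n → Finset (Fin n)) (X : Matrix (Fin j) (Fin n) 𝔽) :
    Submodule 𝔽 (Matrix (Fin j) (Fin n) 𝔽) where
  carrier := {Z | IsPatternDual F (Xᵀ * Z)}
  add_mem' := fun {A B} hA hB => by
    refine ⟨fun a b hab hb => ?_, fun a ha => ?_⟩
    · rw [Matrix.mul_add, Matrix.add_apply, Matrix.add_apply, add_add_add_comm, hA.1 a b hab hb,
        hB.1 a b hab hb, add_zero]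
    · rw [Matrix.mul_add, Matrix.add_apply, hA.2 a ha, hB.2 a ha, add_zero]
  zero_mem' := by simp [IsPatternDual]
  smul_mem' := fun c A hA => by
    refine ⟨fun a b hab hb => ?_, fun a ha => ?_⟩
    · rw [Matrix.mul_smul, Matrix.smul_apply, Matrix.smul_apply, ← smul_add, hA.1 a b hab hb,
        smul_zero]
    · rw [Matrix.mul_smul, Matrix.smul_apply, hA.2 a ha, smul_zero]

/-- The linear map `Z ↦ Xᵀ * Z + Zᵀ * X`. -/
def symmLift (X : Matrix (Fin j) (Fin n) 𝔽) :
    Matrix (Fin j) (Fin n) 𝔽 →ₗ[𝔽] Matrix (Fin n) (Fin n) 𝔽 where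
  toFun Z := Xᵀ * Z + Zᵀ * X
  map_add' A B := by
    rw [Matrix.mul_add, transpose_add, Matrix.add_mul]; abel
  map_smul' c A := by
    rw [Matrix.mul_smul, transpose_smul, Matrix.smul_mul, smul_add]; rfl

/-- The symmetric matrices `Xᵀ * Z + Zᵀ * X` supported on the pattern. -/
def gramSpace (F : Fin n → Finset (Fin n)) (X : Matrix (Fin j) (Fin n) 𝔽) :
    Submodule 𝔽 (Matrix (Fin n) (Fin n) 𝔽) :=
  (dualSolutions F X).map (symmLift X)

theorem exists_of_mem_gramSpace {F : Fin n → Finset (Fin n)} {X : Matrix (Fin j) (Fin n) 𝔽}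
    {B : Matrix (Fin n) (Fin n) 𝔽} (hB : B ∈ gramSpace F X) :
    ∃ Z : Matrix (Fin j) (Fin n) 𝔽, B = Xᵀ * Z + Zᵀ * X := by
  obtain ⟨Z, -, rfl⟩ := hB
  exact ⟨Z, rfl⟩

theorem isSymm_of_mem_gramSpace {F : Fin n → Finset (Fin n)} {X : Matrix (Fin j) (Fin n) 𝔽}
    {B : Matrix (Fin n) (Fin n) 𝔽} (hB : B ∈ gramSpace F X) : B.IsSymm := by
  obtain ⟨Z, rfl⟩ := exists_of_mem_gramSpace hB
  unfold Matrix.IsSymm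
  rw [transpose_add, transpose_mul, transpose_mul, transpose_transpose, transpose_transpose,
    add_comm]

theorem apply_eq_zero_of_mem_gramSpace {F : Fin n → Finset (Fin n)}
    {X : Matrix (Fin j) (Fin n) 𝔽} {B : Matrix (Fin n) (Fin n) 𝔽} (hB : B ∈ gramSpace F X)
    {a b : Fin n} (hab : b ∉ F a) : B a b = 0 := by
  obtain ⟨Z, hZ, rfl⟩ := hB
  have e : (Zᵀ * X) a b = (Xᵀ * Z) b a := by
    rw [← transpose_apply (Xᵀ * Z) a b, transpose_mul, transpose_transpose]
  change (Xᵀ * Z + Zᵀ * X) a b = 0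
  rw [Matrix.add_apply, e]
  by_cases h : a = b
  · subst h
    rw [hZ.2 a hab, add_zero]
  · exact hZ.1 a b h hab

/-- The fibres of `symmLift X` are cosets of its kernel on `dualSolutions F X`, and that kernel is
the space of `Z` with `Xᵀ * Z` alternating. -/
theorem card_dualSolutions [Fintype 𝔽] {F : Fin n → Finset (Fin n)}
    (hodd : Odd (Fintype.card 𝔽) ∨ ∀ i, i ∉ F i) {X : Matrix (Fin j) (Fin n) 𝔽}
    {Y : Matrix (Fin n) (Fin j) 𝔽} (hXY : X * Y = 1) :
    Nat.card {Z : Matrix (Fin j) (Fin n) 𝔽 // IsPatternDual F (Xᵀ * Z)} =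
      Fintype.card 𝔽 ^ (j.choose 2) * Nat.card (gramSpace F X) := by
  let f : dualSolutions F X →ₗ[𝔽] gramSpace F X :=
    ((symmLift X).domRestrict (dualSolutions F X)).codRestrict (gramSpace F X)
      fun Z => Submodule.mem_map_of_mem Z.2
  have hf : Function.Surjective f := by
    rintro ⟨B, Z, hZ, rfl⟩
    exact ⟨⟨Z, hZ⟩, rfl⟩
  have h := card_comap_mul_card f hf ⊥
  have hbot : Nat.card (⊥ : Submodule 𝔽 (gramSpace F X)) = 1 := by simp
  rw [hbot, mul_one] at h
  change _ = Nat.card {Z : Matrix (Fin j) (Fin n) 𝔽 // IsPatternDual F (Xᵀ * Z)} at h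
  rw [← h, ← card_alternating_lifts hXY]
  congr 1
  refine Nat.card_congr
    { toFun := fun Z => ⟨Z.1.1, ?_⟩
      invFun := fun Z => ⟨⟨Z.1, fun a b hab _ => Z.2.1 a b hab (by simp),
        fun a _ => Z.2.2 a (by simp)⟩, ?_⟩
      left_inv := fun _ => rfl
      right_inv := fun _ => rfl }
  · have hZ0 : f Z.1 = 0 := (Submodule.mem_bot 𝔽).1 Z.2
    have hZ : Xᵀ * Z.1.1 + Z.1.1ᵀ * X = 0 := congrArg Subtype.val hZ0
    have hC : ∀ a b, (Xᵀ * Z.1.1) a b + (Xᵀ * Z.1.1) b a = 0 := fun a b => by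
      rw [← transpose_apply (Xᵀ * Z.1.1) a b, transpose_mul, transpose_transpose,
        ← Matrix.add_apply, hZ, Matrix.zero_apply]
    refine ⟨fun a b _ _ => hC a b, fun a _ => ?_⟩
    -- The kernel condition gives only twice the diagonal equal to zero. Either 2 is invertible, or
    -- the diagonal positions are free and orthogonality to the pattern kills them.
    rcases hodd with h2 | hd
    · have h2' : (2 : 𝔽) ≠ 0 := by
        apply Ring.two_ne_zero
        intro h
        have := FiniteField.even_card_iff_char_two.1 h
        rw [Nat.odd_iff] at h2
        omega
      have := hC a a
      rw [← two_mul] at this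
      exact (mul_eq_zero.1 this).resolve_left h2'
    · exact Z.1.2.2 a (hd a)
  · rw [Submodule.comap_bot, LinearMap.mem_ker, Subtype.ext_iff]
    change Xᵀ * Z.1 + Z.1ᵀ * X = 0
    have := Z.2.eq_neg_transpose
    rw [transpose_mul, transpose_transpose] at this
    rw [this, neg_add_cancel]

theorem exists_right_inverse {X : Matrix (Fin j) (Fin n) 𝔽} (hX : LinearIndependent 𝔽 X.row) :
    ∃ Y : Matrix (Fin n) (Fin j) 𝔽, X * Y = 1 := by
  rw [← mulVec_surjective_iff_exists_right_inverse]
  have h1 : X.rank = j := by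
    rw [hX.rank_matrix, Fintype.card_fin]
  rw [← Matrix.coe_mulVecLin, ← LinearMap.range_eq_top]
  apply Submodule.eq_top_of_finrank_eq
  rw [← Matrix.rank, h1]
  simp

theorem card_linearIndependent_ker [Fintype 𝔽] (M : Matrix (Fin n) (Fin n) 𝔽) (j : ℕ) :
    (Nat.card {X : Matrix (Fin j) (Fin n) 𝔽 // LinearIndependent 𝔽 X.row ∧ M * Xᵀ = 0} : ℝ) =
      qFalling (Fintype.card 𝔽) j ((Fintype.card 𝔽 : ℝ) ^ (n - M.rank)) := by
  classical
  have hker : finrank 𝔽 (LinearMap.ker M.mulVecLin) = n - M.rank := by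
    have := LinearMap.finrank_range_add_finrank_ker M.mulVecLin
    rw [← Matrix.rank, finrank_fin_fun] at this
    omega
  have hmem : ∀ X : Matrix (Fin j) (Fin n) 𝔽,
      M * Xᵀ = 0 ↔ ∀ t, X t ∈ LinearMap.ker M.mulVecLin := by
    intro X
    simp only [LinearMap.mem_ker, mulVecLin_apply]
    constructor
    · intro h t
      ext a
      exact congrFun (congrFun h a) t
    · intro h
      ext a t
      exact congrFun (h t) a
  have hcard : Nat.card {X : Matrix (Fin j) (Fin n) 𝔽 //
      LinearIndependent 𝔽 X.row ∧ M * Xᵀ = 0} =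
      Nat.card {s : Fin j → LinearMap.ker M.mulVecLin // LinearIndependent 𝔽 s} := by
    refine Nat.card_congr
      { toFun := fun X => ⟨fun t => ⟨X.1 t, (hmem X.1).1 X.2.2 t⟩, ?_⟩
        invFun := fun s => ⟨fun t => (s.1 t).1, ?_, ?_⟩
        left_inv := fun _ => rfl
        right_inv := fun _ => rfl }
    · exact LinearIndependent.of_comp (LinearMap.ker M.mulVecLin).subtype X.2.1
    · exact s.2.map' (LinearMap.ker M.mulVecLin).subtype (Submodule.ker_subtype _)
    · exact (hmem _).2 fun t => (s.1 t).2
  rw [hcard]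
  rcases le_or_gt j (n - M.rank) with h | h
  · rw [card_linearIndependent (by rw [hker]; exact h), hker, qFalling, ← Fin.prod_univ_eq_prod_range
      (fun i => (Fintype.card 𝔽 : ℝ) ^ (n - M.rank) - (Fintype.card 𝔽 : ℝ) ^ i) j]
    push_cast
    refine Finset.prod_congr rfl fun i _ => ?_
    rw [Nat.cast_sub (Nat.pow_le_pow_right Fintype.card_pos (by omega))]
    push_cast
    rfl
  · rw [qFalling_eq_zero h]
    have : IsEmpty {s : Fin j → LinearMap.ker M.mulVecLin // LinearIndependent 𝔽 s} := by
      refine ⟨fun s => ?_⟩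
      have := s.2.fintype_card_le_finrank
      rw [hker, Fintype.card_fin] at this
      omega
    rw [Nat.card_of_isEmpty, Nat.cast_zero]

/-- Double counting of pairs `(M, X)` with `M * Xᵀ = 0` and `X` of full row rank. -/
theorem sum_qFalling_corank [Fintype 𝔽] {F : Fin n → Finset (Fin n)}
    (hF : ∀ i j, i ∈ F j ↔ j ∈ F i) (hodd : Odd (Fintype.card 𝔽) ∨ ∀ i, i ∉ F i)
    [Fintype (symmPattern 𝔽 F)] (j : ℕ)
    [Fintype {X : Matrix (Fin j) (Fin n) 𝔽 // LinearIndependent 𝔽 X.row}] :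
    ∑ M : symmPattern 𝔽 F,
        qFalling (Fintype.card 𝔽) j ((Fintype.card 𝔽 : ℝ) ^ (n - M.1.rank)) =
      Fintype.card (symmPattern 𝔽 F) * ((Fintype.card 𝔽 : ℝ) ^ (j.choose 2) *
        ((∑ X : {X : Matrix (Fin j) (Fin n) 𝔽 // LinearIndependent 𝔽 X.row},
          (Nat.card (gramSpace F X.1) : ℝ)) / (Fintype.card 𝔽 : ℝ) ^ (j * n))) := by
  have hq : (0 : ℝ) < (Fintype.card 𝔽 : ℝ) ^ (j * n) := by
    have : 0 < Fintype.card 𝔽 := Fintype.card_pos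
    positivity
  have hX : ∀ X : {X : Matrix (Fin j) (Fin n) 𝔽 // LinearIndependent 𝔽 X.row},
      (Nat.card {M : symmPattern 𝔽 F // M.1 * X.1ᵀ = 0} : ℝ) =
        Fintype.card (symmPattern 𝔽 F) * ((Fintype.card 𝔽 : ℝ) ^ (j.choose 2) *
          Nat.card (gramSpace F X.1)) / (Fintype.card 𝔽 : ℝ) ^ (j * n) := by
    intro X
    obtain ⟨Y, hY⟩ := exists_right_inverse X.2
    have h := card_mul_transpose_eq_zero hF X.1
    rw [card_dualSolutions hodd hY, Nat.card_eq_fintype_card (α := symmPattern 𝔽 F)] at h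
    rw [eq_div_iff hq.ne']
    exact_mod_cast h
  have hswap : ∑ M : symmPattern 𝔽 F, Nat.card {X : Matrix (Fin j) (Fin n) 𝔽 //
        LinearIndependent 𝔽 X.row ∧ M.1 * Xᵀ = 0} =
      ∑ X : {X : Matrix (Fin j) (Fin n) 𝔽 // LinearIndependent 𝔽 X.row},
        Nat.card {M : symmPattern 𝔽 F // M.1 * X.1ᵀ = 0} := by
    rw [← Nat.card_sigma, ← Nat.card_sigma]
    exact Nat.card_congr
      { toFun := fun p => ⟨⟨p.2.1, p.2.2.1⟩, ⟨p.1, p.2.2.2⟩⟩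
        invFun := fun p => ⟨p.2.1, ⟨p.1.1, p.1.2, p.2.2⟩⟩
        left_inv := fun _ => rfl
        right_inv := fun _ => rfl }
  have hswap' := congrArg (Nat.cast : ℕ → ℝ) hswap
  push_cast at hswap'
  simp only [card_linearIndependent_ker, hX] at hswap'
  rw [hswap', ← Finset.sum_div, ← Finset.mul_sum, ← Finset.mul_sum]
  ring

end Gram

/-! ### Nonzero matrices in the Gram spaces contribute little -/

section GramBound

open Matrix Module

variable {𝔽 : Type*} [Field 𝔽] {n j : ℕ}

/-- If `B = Xᵀ * Z + Zᵀ * X` with `X` of full row rank, then the row space of `X` meets the image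
of `B` in dimension at least half the rank of `B`. -/
theorem rank_le_two_mul_finrank_comap {X Z : Matrix (Fin j) (Fin n) 𝔽}
    {Y : Matrix (Fin n) (Fin j) 𝔽} (hXY : X * Y = 1) {B : Matrix (Fin n) (Fin n) 𝔽}
    (hB : B = Xᵀ * Z + Zᵀ * X) :
    B.rank ≤ 2 * finrank 𝔽 ((LinearMap.range B.mulVecLin).comap Xᵀ.mulVecLin) := by
  have hYX : Yᵀ * Xᵀ = 1 := by rw [← transpose_mul, hXY, transpose_one]
  have hBs : Bᵀ = B := by
    rw [hB, transpose_add, transpose_mul, transpose_mul, transpose_transpose,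
      transpose_transpose, add_comm]
  -- `P` is a projection killing exactly the row space of `X`, so `P * B * Pᵀ = 0`. Thus `B * Pᵀ`
  -- has image in `D`, the part of the image of `B` killed by `P`. Its rank equals that of `P * B`
  -- because `B` is symmetric, and rank-nullity for `P` on the image of `B` gives `rank B ≤ 2 * dim
  -- D`.
  set P : Matrix (Fin n) (Fin n) 𝔽 := 1 - Xᵀ * Yᵀ with hP
  have hPX : P * Xᵀ = 0 := by
    rw [hP, Matrix.sub_mul, Matrix.mul_assoc, hYX, Matrix.one_mul, Matrix.mul_one, sub_self]
  have hXP : X * Pᵀ = 0 := by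
    rw [← transpose_transpose X, ← transpose_mul, hPX, transpose_zero]
  have hPBP : P * (B * Pᵀ) = 0 := by
    rw [hB, Matrix.add_mul, Matrix.mul_add, Matrix.mul_assoc Zᵀ, hXP, Matrix.mul_zero,
      Matrix.mul_zero, add_zero, Matrix.mul_assoc Xᵀ, ← Matrix.mul_assoc P, hPX, Matrix.zero_mul]
  set D := LinearMap.range B.mulVecLin ⊓ LinearMap.ker P.mulVecLin with hD
  have h1 : (P * B).rank + finrank 𝔽 D = B.rank := by
    have h := LinearMap.finrank_range_add_finrank_ker
      (P.mulVecLin.domRestrict (LinearMap.range B.mulVecLin))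
    rw [LinearMap.range_domRestrict, ← LinearMap.range_comp, ← mulVecLin_mul,
      LinearMap.ker_domRestrict, ← Submodule.finrank_map_subtype_eq,
      Submodule.map_comap_subtype] at h
    exact h
  have h2 : (B * Pᵀ).rank ≤ finrank 𝔽 D := by
    refine Submodule.finrank_mono ?_
    rintro _ ⟨v, rfl⟩
    refine ⟨⟨Pᵀ *ᵥ v, ?_⟩, ?_⟩
    · rw [mulVecLin_apply, mulVecLin_apply, Matrix.mulVec_mulVec]
    · rw [SetLike.mem_coe, LinearMap.mem_ker, mulVecLin_apply, mulVecLin_apply, Matrix.mulVec_mulVec, hPBP,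
        Matrix.zero_mulVec]
  have h3 : (B * Pᵀ).rank = (P * B).rank := by
    rw [← rank_transpose, transpose_mul, transpose_transpose, hBs]
  have h4 : finrank 𝔽 D ≤
      finrank 𝔽 ((LinearMap.range B.mulVecLin).comap Xᵀ.mulVecLin) := by
    refine le_trans (Submodule.finrank_mono ?_)
      (Submodule.finrank_map_le Xᵀ.mulVecLin
        ((LinearMap.range B.mulVecLin).comap Xᵀ.mulVecLin))
    rintro v ⟨hv1, hv2⟩
    have hv : Xᵀ *ᵥ (Yᵀ *ᵥ v) = v := by
      have hv2' : P *ᵥ v = 0 := hv2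
      rw [hP, Matrix.sub_mulVec, Matrix.one_mulVec, sub_eq_zero] at hv2'
      rw [Matrix.mulVec_mulVec, ← hv2']
    refine ⟨Yᵀ *ᵥ v, ?_, hv⟩
    change Xᵀ *ᵥ (Yᵀ *ᵥ v) ∈ LinearMap.range B.mulVecLin
    rw [hv]
    exact hv1
  omega

theorem natCard_pi_submodule [Fintype 𝔽] (R : Submodule 𝔽 (Fin n → 𝔽)) (m : ℕ) :
    Nat.card {Y : Matrix (Fin m) (Fin n) 𝔽 // ∀ s, Y s ∈ R} =
      Fintype.card 𝔽 ^ (finrank 𝔽 R * m) := by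
  have e : {Y : Matrix (Fin m) (Fin n) 𝔽 // ∀ s, Y s ∈ R} ≃ (Fin m → R) :=
    { toFun := fun Y s => ⟨Y.1 s, Y.2 s⟩
      invFun := fun g => ⟨fun s => (g s).1, fun s => (g s).2⟩
      left_inv := fun _ => rfl
      right_inv := fun _ => rfl }
  rw [Nat.card_congr e, Nat.card_fun, Module.natCard_eq_pow_finrank (K := 𝔽), Nat.card_fin,
    Nat.card_eq_fintype_card, ← pow_mul]

/-- Since `T` has a right inverse, `X ↦ T * X` is onto, so `T * X` is equidistributed. -/
theorem card_rows_mul_mem [Fintype 𝔽] {m : ℕ} {T : Matrix (Fin m) (Fin j) 𝔽}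
    (hT : LinearIndependent 𝔽 T.row) (R : Submodule 𝔽 (Fin n → 𝔽)) :
    Nat.card {X : Matrix (Fin j) (Fin n) 𝔽 // ∀ s, (T * X) s ∈ R} * Fintype.card 𝔽 ^ (m * n) =
      Fintype.card 𝔽 ^ (j * n) * Fintype.card 𝔽 ^ (finrank 𝔽 R * m) := by
  obtain ⟨U, hU⟩ := exists_right_inverse hT
  let S : Submodule 𝔽 (Matrix (Fin m) (Fin n) 𝔽) :=
    { carrier := {Y | ∀ s, Y s ∈ R}
      add_mem' := fun hA hB s => R.add_mem (hA s) (hB s)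
      zero_mem' := fun _ => R.zero_mem
      smul_mem' := fun c _ hA s => R.smul_mem c (hA s) }
  let φ : Matrix (Fin j) (Fin n) 𝔽 →ₗ[𝔽] Matrix (Fin m) (Fin n) 𝔽 :=
    { toFun := fun X => T * X
      map_add' := fun A B => Matrix.mul_add _ _ _
      map_smul' := fun c A => Matrix.mul_smul _ _ _ }
  have hφ : Function.Surjective φ := fun Y => ⟨U * Y, by
    change T * (U * Y) = Y
    rw [← Matrix.mul_assoc, hU, Matrix.one_mul]⟩
  have h := card_comap_mul_card φ hφ S
  rw [natCard_matrix, natCard_matrix] at h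
  have h2 : Nat.card S = Fintype.card 𝔽 ^ (finrank 𝔽 R * m) := natCard_pi_submodule R m
  rw [h2] at h
  exact h

/-- A union bound: each such `X` admits about `rank B / 2` (rounded up) independent combinations of
its rows lying in the image of `B`. The coefficient matrix `T` is one of at most `q ^ (m * j)`, and
for fixed `T` the matrices `X` are counted exactly. -/
theorem card_mem_gramSpace_mul_le [Fintype 𝔽] (F : Fin n → Finset (Fin n))
    (B : Matrix (Fin n) (Fin n) 𝔽) :
    Nat.card {X : {X : Matrix (Fin j) (Fin n) 𝔽 // LinearIndependent 𝔽 X.row} //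
        B ∈ gramSpace F X.1} * Fintype.card 𝔽 ^ ((B.rank + 1) / 2 * n) ≤
      Fintype.card 𝔽 ^ ((B.rank + 1) / 2 * j) *
        (Fintype.card 𝔽 ^ (j * n) * Fintype.card 𝔽 ^ (B.rank * ((B.rank + 1) / 2))) := by
  classical
  set m := (B.rank + 1) / 2 with hm
  set R := LinearMap.range B.mulVecLin with hR
  have hR' : finrank 𝔽 R = B.rank := rfl
  have hex : ∀ X : {X : {X : Matrix (Fin j) (Fin n) 𝔽 // LinearIndependent 𝔽 X.row} //
        B ∈ gramSpace F X.1}, ∃ T : {T : Matrix (Fin m) (Fin j) 𝔽 // LinearIndependent 𝔽 T.row},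
        ∀ s, (T.1 * X.1.1) s ∈ R := by
    rintro ⟨⟨X, hX⟩, hBX⟩
    obtain ⟨Y, hY⟩ := exists_right_inverse hX
    obtain ⟨Z, hZ⟩ := exists_of_mem_gramSpace hBX
    have h1 := rank_le_two_mul_finrank_comap hY hZ
    have h2 : m ≤ finrank 𝔽 (R.comap Xᵀ.mulVecLin) := by
      rw [← hR] at h1; omega
    obtain ⟨g, hg⟩ := exists_linearIndependent_of_le_finrank h2
    refine ⟨⟨fun s => (g s).1, hg.map' (R.comap Xᵀ.mulVecLin).subtype
      (Submodule.ker_subtype _)⟩, fun s => ?_⟩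
    have h3 : Xᵀ *ᵥ (g s).1 ∈ R := (g s).2
    rw [Matrix.mulVec_transpose] at h3
    exact h3
  choose T hT using hex
  have hinj : Nat.card {X : {X : Matrix (Fin j) (Fin n) 𝔽 // LinearIndependent 𝔽 X.row} //
        B ∈ gramSpace F X.1} ≤
      Nat.card (Σ T : {T : Matrix (Fin m) (Fin j) 𝔽 // LinearIndependent 𝔽 T.row},
        {X : Matrix (Fin j) (Fin n) 𝔽 // ∀ s, (T.1 * X) s ∈ R}) := by
    refine Nat.card_le_card_of_injective (fun X => ⟨T X, ⟨X.1.1, hT X⟩⟩) fun X X' h => ?_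
    have h' := congrArg (fun p => p.2.1) h
    exact Subtype.ext (Subtype.ext h')
  refine (Nat.mul_le_mul_right _ hinj).trans ?_
  rw [Nat.card_sigma, Finset.sum_mul]
  refine (Finset.sum_le_sum fun T _ => (card_rows_mul_mem T.2 R).le).trans ?_
  rw [Finset.sum_const, smul_eq_mul, hR']
  refine Nat.mul_le_mul_right _ ?_
  rw [Finset.card_univ, ← natCard_matrix 𝔽 m j, ← Nat.card_eq_fintype_card]
  exact Nat.card_le_card_of_injective _ Subtype.val_injective

theorem rank_le_of_mem_gramSpace {F : Fin n → Finset (Fin n)} {X : Matrix (Fin j) (Fin n) 𝔽}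
    (hX : LinearIndependent 𝔽 X.row) {B : Matrix (Fin n) (Fin n) 𝔽} (hB : B ∈ gramSpace F X) :
    B.rank ≤ 2 * j := by
  obtain ⟨Y, hY⟩ := exists_right_inverse hX
  obtain ⟨Z, hZ⟩ := exists_of_mem_gramSpace hB
  refine (rank_le_two_mul_finrank_comap hY hZ).trans (Nat.mul_le_mul_left 2 ?_)
  exact (Submodule.finrank_le _).trans (by simp)

theorem card_mem_gramSpace_le [Fintype 𝔽] (F : Fin n → Finset (Fin n))
    (B : Matrix (Fin n) (Fin n) 𝔽) {h : ℕ} (hjn : 3 * j + 2 * h ≤ n) :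
    (Nat.card {X : {X : Matrix (Fin j) (Fin n) 𝔽 // LinearIndependent 𝔽 X.row} //
        B ∈ gramSpace F X.1} : ℝ) ≤
      (Fintype.card 𝔽 : ℝ) ^ (j * n) * (1 / (Fintype.card 𝔽 : ℝ) ^ h) ^ B.rank := by
  have hq : 1 ≤ Fintype.card 𝔽 := Fintype.card_pos
  have hq' : (1 : ℝ) ≤ Fintype.card 𝔽 := by exact_mod_cast hq
  have hq0 : (0 : ℝ) < Fintype.card 𝔽 := by linarith
  rcases Nat.eq_zero_or_pos (Nat.card {X : {X : Matrix (Fin j) (Fin n) 𝔽 //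
      LinearIndependent 𝔽 X.row} // B ∈ gramSpace F X.1}) with h0 | h0
  · rw [h0, Nat.cast_zero]
    positivity
  · obtain ⟨⟨⟨X, hX⟩, hBX⟩⟩ := (Nat.card_pos_iff.1 h0).1
    have hr := rank_le_of_mem_gramSpace hX hBX
    have hmain := card_mem_gramSpace_mul_le (j := j) F B
    set N := Nat.card {X : {X : Matrix (Fin j) (Fin n) 𝔽 //
      LinearIndependent 𝔽 X.row} // B ∈ gramSpace F X.1}
    set m := (B.rank + 1) / 2 with hm
    rw [div_pow, one_pow, mul_one_div, le_div_iff₀ (by positivity), ← pow_mul]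
    have h1 : N * Fintype.card 𝔽 ^ (h * B.rank) ≤ Fintype.card 𝔽 ^ (j * n) := by
      -- As `rank B ≤ 2 * j`, the saving `m * (n - j - rank B)` is at least `m * (n - 3 * j) ≥ 2 * h
      -- * m ≥ h * rank B`.
      have h2 : m * j + B.rank * m + h * B.rank ≤ m * n := by
        have h3 : B.rank ≤ 2 * m := by omega
        have h4 : h * B.rank ≤ h * (2 * m) := Nat.mul_le_mul_left _ h3
        have h5 : m * (3 * j + 2 * h) ≤ m * n := Nat.mul_le_mul_left _ hjn
        have h6 : B.rank * m ≤ 2 * j * m := Nat.mul_le_mul_right _ hr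
        nlinarith
      have h3 : Fintype.card 𝔽 ^ (m * j + B.rank * m + h * B.rank) ≤
          Fintype.card 𝔽 ^ (m * n) := Nat.pow_le_pow_right hq h2
      have h4 : 0 < Fintype.card 𝔽 ^ (m * j + B.rank * m) := pow_pos hq _
      refine Nat.le_of_mul_le_mul_left ?_ h4
      calc Fintype.card 𝔽 ^ (m * j + B.rank * m) * (N * Fintype.card 𝔽 ^ (h * B.rank))
          = N * Fintype.card 𝔽 ^ (m * j + B.rank * m + h * B.rank) := by rw [pow_add _ (_ + _)]; ring
        _ ≤ N * Fintype.card 𝔽 ^ (m * n) := Nat.mul_le_mul_left _ h3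
        _ ≤ _ := hmain
        _ = _ := by rw [pow_add]; ring
    exact_mod_cast h1

/-- A symmetric matrix is determined by rows that span its row space. -/
theorem eq_of_rows_eq {B B' : Matrix (Fin n) (Fin n) 𝔽} (hB : B.IsSymm) (hB' : B'.IsSymm)
    (I : Finset (Fin n)) (hI : ∀ b, B b ∈ Submodule.span 𝔽 (B '' I))
    (hI' : ∀ b, B' b ∈ Submodule.span 𝔽 (B' '' I)) (h : ∀ a ∈ I, B a = B' a) : B = B' := by
  have himg : B' '' (I : Set (Fin n)) = B '' I := Set.image_congr fun a ha => (h a ha).symm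
  rw [himg] at hI'
  funext b
  rw [← sub_eq_zero]
  set d := B b - B' b with hd
  have hdI : ∀ a ∈ I, d a = 0 := fun a ha => by
    rw [hd, Pi.sub_apply, ← hB.apply b a, ← hB'.apply b a, h a ha, sub_self]
  have hmem : d ∈ Submodule.span 𝔽 (B '' I) := Submodule.sub_mem _ (hI b) (hI' b)
  obtain ⟨e, he⟩ := Submodule.mem_span_image_finset_iff_exists_fun' 𝔽 |>.1 hmem
  have hde : ∀ c, d c = ∑ a ∈ I, e a * B c a := fun c => by
    rw [← he, Finset.sum_apply]
    exact Finset.sum_congr rfl fun a _ => by rw [Pi.smul_apply, smul_eq_mul, hB.apply c a]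
  -- By symmetry `d c` is the functional with coefficients `e` applied to the row `B c`. It vanishes
  -- on the rows indexed by `I`, since `d` vanishes on `I`, hence on their span, which contains
  -- every row.
  have hvan : ∀ v ∈ Submodule.span 𝔽 (B '' I), ∑ a ∈ I, e a * v a = 0 := by
    intro v hv
    induction hv using Submodule.span_induction with
    | mem v hv =>
      obtain ⟨a, ha, rfl⟩ := hv
      rw [← hde, hdI a ha]
    | zero => simp
    | add v w _ _ hv hw => simp [mul_add, Finset.sum_add_distrib, hv, hw]
    | smul c v _ hv =>
      simp only [Pi.smul_apply, smul_eq_mul, mul_left_comm _ c]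
      rw [← Finset.mul_sum, hv, mul_zero]
  ext c
  rw [hde c, hvan _ (hI c), Pi.zero_apply]

theorem exists_spanning_rows (B : Matrix (Fin n) (Fin n) 𝔽) :
    ∃ I : Finset (Fin n), I.card = B.rank ∧ ∀ b, B b ∈ Submodule.span 𝔽 (B '' I) := by
  classical
  obtain ⟨κ, a, ha, hspan, hli⟩ := exists_linearIndependent' 𝔽 B.row
  have : Finite κ := Finite.of_injective a ha
  have : Fintype κ := Fintype.ofFinite κ
  have himg : B '' ((Finset.univ.image a : Finset (Fin n)) : Set (Fin n)) =
      Set.range (B.row ∘ a) := by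
    rw [Finset.coe_image, Finset.coe_univ, Set.image_univ, Set.range_comp]
    rfl
  refine ⟨Finset.univ.image a, ?_, fun b => ?_⟩
  · rw [Finset.card_image_of_injective _ ha, Finset.card_univ, rank_eq_finrank_span_row, ← hspan,
      finrank_span_eq_card hli]
  · rw [himg, hspan]
    exact Submodule.subset_span ⟨b, rfl⟩

theorem eq_zero_of_rank_eq_zero {B : Matrix (Fin n) (Fin n) 𝔽} (h : B.rank = 0) : B = 0 := by
  have h1 : LinearMap.range B.mulVecLin = ⊥ := Submodule.finrank_eq_zero.1 h
  have h2 : B.mulVecLin = 0 := LinearMap.range_eq_bot.1 h1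
  ext a b
  have h3 := congrFun (LinearMap.congr_fun h2 (Pi.single b 1)) a
  simpa using h3

/-- Group the matrices by an index set `J` of `rank B` spanning rows. Those rows determine `B` and
have at most `f` allowed positions each, so the group of `J` contributes at most `(q ^ f * y) ^
J.card`; the binomial theorem sums over `J`, and `J = ∅` is excluded because `B ≠ 0`. -/
theorem sum_pow_rank_le [Fintype 𝔽] {F : Fin n → Finset (Fin n)} {f : ℕ}
    (hf : ∀ i, (F i).card ≤ f) {y : ℝ} (hy : 0 ≤ y)
    (S : Finset (Matrix (Fin n) (Fin n) 𝔽))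
    (hS : ∀ B ∈ S, B ≠ 0 ∧ B.IsSymm ∧ ∀ a b, b ∉ F a → B a b = 0) :
    ∑ B ∈ S, y ^ B.rank ≤ (1 + (Fintype.card 𝔽 : ℝ) ^ f * y) ^ n - 1 := by
  classical
  choose I hIcard hIspan using exists_spanning_rows (𝔽 := 𝔽) (n := n)
  have hfib : ∀ J : Finset (Fin n),
      ∑ B ∈ S with I B = J, y ^ B.rank ≤ if J = ∅ then 0 else ((Fintype.card 𝔽 : ℝ) ^ f * y) ^ J.card := by
    intro J
    split_ifs with hJ
    · rw [Finset.sum_eq_zero]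
      intro B hB
      obtain ⟨hBS, hBJ⟩ := Finset.mem_filter.1 hB
      exfalso
      have h1 := hIcard B
      rw [hBJ, hJ, Finset.card_empty] at h1
      exact (hS B hBS).1 (eq_zero_of_rank_eq_zero h1.symm)
    · have h1 : ∑ B ∈ S with I B = J, y ^ B.rank = (S.filter fun B => I B = J).card * y ^ J.card := by
        rw [← nsmul_eq_mul, ← Finset.sum_const]
        refine Finset.sum_congr rfl fun B hB => ?_
        rw [← hIcard B, (Finset.mem_filter.1 hB).2]
      have h2 : (S.filter fun B => I B = J).card ≤ (Fintype.card 𝔽 ^ f) ^ J.card := by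
        have hle : (S.filter fun B => I B = J).card ≤
            Fintype.card ((a : J) → (F a → 𝔽)) := by
          rw [← Finset.card_univ]
          refine Finset.card_le_card_of_injOn (fun B a b => B a.1 b.1)
            (fun _ _ => Finset.mem_coe.2 (Finset.mem_univ _)) ?_
          intro B hB B' hB' hBB'
          obtain ⟨hBS, hBJ⟩ := Finset.mem_filter.1 (Finset.mem_coe.1 hB)
          obtain ⟨hBS', hBJ'⟩ := Finset.mem_filter.1 (Finset.mem_coe.1 hB')
          have h3 := hIspan B
          have h4 := hIspan B'
          rw [hBJ] at h3
          rw [hBJ'] at h4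
          refine eq_of_rows_eq (hS B hBS).2.1 (hS B' hBS').2.1 J h3 h4 fun a ha => ?_
          funext b
          by_cases hb : b ∈ F a
          · exact congrFun (congrFun hBB' ⟨a, ha⟩) ⟨b, hb⟩
          · rw [(hS B hBS).2.2 a b hb, (hS B' hBS').2.2 a b hb]
        refine hle.trans ?_
        rw [Fintype.card_pi]
        simp only [Fintype.card_fun, Fintype.card_coe]
        refine (Finset.prod_le_prod' (g := fun _ => Fintype.card 𝔽 ^ f) fun a _ =>
          Nat.pow_le_pow_right Fintype.card_pos (hf a.1)).trans ?_
        simp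
      rw [h1, mul_pow]
      have h3 : ((S.filter fun B => I B = J).card : ℝ) ≤ ((Fintype.card 𝔽 : ℝ) ^ f) ^ J.card := by
        exact_mod_cast h2
      exact mul_le_mul_of_nonneg_right h3 (by positivity)
  have hbin := Fin.sum_pow_mul_eq_add_pow (n := n) ((Fintype.card 𝔽 : ℝ) ^ f * y) 1
  simp only [one_pow, mul_one] at hbin
  rw [← Finset.sum_fiberwise S I, add_comm, ← hbin,
    ← Finset.add_sum_erase _ _ (Finset.mem_univ (∅ : Finset (Fin n))),
    ← Finset.add_sum_erase _
      (fun J : Finset (Fin n) => (_ : ℝ) ^ J.card)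
      (Finset.mem_univ (∅ : Finset (Fin n))), Finset.card_empty, pow_zero, add_sub_cancel_left]
  have h0 := hfib ∅
  rw [if_pos rfl] at h0
  have h1 : ∑ J ∈ Finset.univ.erase (∅ : Finset (Fin n)), ∑ B ∈ S with I B = J, y ^ B.rank ≤
      ∑ J ∈ Finset.univ.erase (∅ : Finset (Fin n)), ((Fintype.card 𝔽 : ℝ) ^ f * y) ^ J.card :=
    Finset.sum_le_sum fun J hJ => by
      have := hfib J
      rwa [if_neg (Finset.ne_of_mem_erase hJ)] at this
  linarith

/-- Exchanging the sums over `X` and `B`, the matrix `B = 0` gives the first summand and the nonzero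
`B` give the second. -/
theorem sum_card_gramSpace_le [Fintype 𝔽] {F : Fin n → Finset (Fin n)} {f h : ℕ}
    (hf : ∀ i, (F i).card ≤ f) (hjn : 3 * j + 2 * h ≤ n)
    [Fintype {X : Matrix (Fin j) (Fin n) 𝔽 // LinearIndependent 𝔽 X.row}] :
    ∑ X : {X : Matrix (Fin j) (Fin n) 𝔽 // LinearIndependent 𝔽 X.row},
        (Nat.card (gramSpace F X.1) : ℝ) ≤
      Fintype.card {X : Matrix (Fin j) (Fin n) 𝔽 // LinearIndependent 𝔽 X.row} +
        (Fintype.card 𝔽 : ℝ) ^ (j * n) *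
          ((1 + (Fintype.card 𝔽 : ℝ) ^ f * (1 / (Fintype.card 𝔽 : ℝ) ^ h)) ^ n - 1) := by
  classical
  have hswap : ∑ X : {X : Matrix (Fin j) (Fin n) 𝔽 // LinearIndependent 𝔽 X.row},
        Nat.card (gramSpace F X.1) =
      ∑ B : Matrix (Fin n) (Fin n) 𝔽,
        Nat.card {X : {X : Matrix (Fin j) (Fin n) 𝔽 // LinearIndependent 𝔽 X.row} //
          B ∈ gramSpace F X.1} := by
    rw [← Nat.card_sigma, ← Nat.card_sigma]
    exact Nat.card_congr
      { toFun := fun p => ⟨p.2.1, ⟨p.1, p.2.2⟩⟩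
        invFun := fun p => ⟨p.2.1, ⟨p.1, p.2.2⟩⟩
        left_inv := fun _ => rfl
        right_inv := fun _ => rfl }
  have hswap' := congrArg (Nat.cast : ℕ → ℝ) hswap
  push_cast at hswap'
  rw [hswap', ← Finset.add_sum_erase _ _ (Finset.mem_univ (0 : Matrix (Fin n) (Fin n) 𝔽))]
  refine add_le_add ?_ ?_
  · rw [← Nat.card_eq_fintype_card]
    exact_mod_cast Nat.card_le_card_of_injective _ Subtype.val_injective
  · set S := (Finset.univ.erase (0 : Matrix (Fin n) (Fin n) 𝔽)).filter
      (fun B => B.IsSymm ∧ ∀ a b, b ∉ F a → B a b = 0) with hS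
    have hsub : ∑ B ∈ Finset.univ.erase (0 : Matrix (Fin n) (Fin n) 𝔽),
        (Nat.card {X : {X : Matrix (Fin j) (Fin n) 𝔽 // LinearIndependent 𝔽 X.row} //
          B ∈ gramSpace F X.1} : ℝ) = ∑ B ∈ S,
        (Nat.card {X : {X : Matrix (Fin j) (Fin n) 𝔽 // LinearIndependent 𝔽 X.row} //
          B ∈ gramSpace F X.1} : ℝ) := by
      refine (Finset.sum_subset (Finset.filter_subset _ _) fun B hB hBS => ?_).symm
      have : IsEmpty {X : {X : Matrix (Fin j) (Fin n) 𝔽 // LinearIndependent 𝔽 X.row} //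
          B ∈ gramSpace F X.1} := ⟨fun X => hBS (Finset.mem_filter.2
            ⟨hB, isSymm_of_mem_gramSpace X.2, fun a b hab =>
              apply_eq_zero_of_mem_gramSpace X.2 hab⟩)⟩
      rw [Nat.card_of_isEmpty, Nat.cast_zero]
    rw [hsub]
    refine (Finset.sum_le_sum fun B _ => card_mem_gramSpace_le F B hjn).trans ?_
    rw [← Finset.mul_sum]
    refine mul_le_mul_of_nonneg_left (sum_pow_rank_le hf (by positivity) S fun B hB => ?_)
      (by positivity)
    obtain ⟨h1, h2, h3⟩ := Finset.mem_filter.1 hB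
    exact ⟨Finset.ne_of_mem_erase h1, h2, h3⟩

end GramBound

/-! ### Explicit error bounds -/

section Main

open Matrix Module

variable {𝔽 : Type*} [Field 𝔽] {n : ℕ}

/-- Step `i` fails with probability `q ^ i / q ^ n`; these form a geometric sum of ratio at least 2,
hence the factor 2. -/
theorem one_sub_le_qFalling_div {q : ℝ} (hq : 2 ≤ q) {j n : ℕ} (hj : j ≤ n) :
    1 - 2 * q ^ j / q ^ (n + 1) ≤ qFalling q j (q ^ n) / q ^ (j * n) := by
  have hq0 : 0 < q := by linarith
  induction j with
  | zero =>
    simp only [qFalling_zero, pow_zero, zero_mul, div_one]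
    have : 0 < 2 * 1 / q ^ (n + 1) := by positivity
    linarith
  | succ j ih =>
    have ih := ih (by omega)
    have hb1 : q ^ j / q ^ n ≤ 1 := by
      rw [div_le_one (by positivity)]
      exact pow_le_pow_right₀ (by linarith) (by omega)
    have hb0 : 0 < q ^ j / q ^ n := by positivity
    have e1 : qFalling q (j + 1) (q ^ n) / q ^ ((j + 1) * n) =
        qFalling q j (q ^ n) / q ^ (j * n) * (1 - q ^ j / q ^ n) := by
      rw [qFalling_succ, add_mul, one_mul, pow_add]
      field_simp
    have e2 : 2 * q ^ (j + 1) / q ^ (n + 1) = 2 * (q ^ j / q ^ n) := by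
      rw [pow_succ, pow_succ]
      field_simp
    have e3 : 2 * q ^ j / q ^ (n + 1) ≤ q ^ j / q ^ n := by
      rw [pow_succ, div_le_div_iff₀ (by positivity) (by positivity)]
      have : 0 < q ^ j * q ^ n := by positivity
      nlinarith
    have e4 : 0 < 2 * q ^ j / q ^ (n + 1) := by positivity
    rw [e1, e2]
    nlinarith

theorem card_fullRank [Fintype 𝔽] (j n : ℕ) :
    (Nat.card {X : Matrix (Fin j) (Fin n) 𝔽 // LinearIndependent 𝔽 X.row} : ℝ) =
      qFalling (Fintype.card 𝔽) j ((Fintype.card 𝔽 : ℝ) ^ n) := by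
  have h := card_linearIndependent_ker (0 : Matrix (Fin n) (Fin n) 𝔽) j
  rw [rank_zero, Nat.sub_zero] at h
  rw [← h]
  simp

theorem symmCount_eq [Fintype 𝔽] (F : Fin n → Finset (Fin n)) {k r : ℕ} (hr : r ≤ n)
    (hk : n - r = k) :
    symmCount 𝔽 F r = Nat.card {M : symmPattern 𝔽 F // n - M.1.rank = k} := by
  refine Nat.card_congr
    { toFun := fun M => ⟨⟨M.1, M.2.1, M.2.2.1⟩, by rw [← hk, M.2.2.2]⟩
      invFun := fun M => ⟨M.1.1, M.1.2.1, M.1.2.2, ?_⟩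
      left_inv := fun _ => rfl
      right_inv := fun _ => rfl }
  have h1 := M.2
  have h2 : M.1.1.rank ≤ n := by simpa using M.1.1.rank_le_width
  omega

theorem card_symmPattern_zpow [Fintype 𝔽] {F : Fin n → Finset (Fin n)}
    (hF : ∀ i j, i ∈ F j ↔ j ∈ F i) :
    (Nat.card (symmPattern 𝔽 F) : ℝ) = (Fintype.card 𝔽 : ℝ) ^ freeEntries F := by
  rw [card_symmPattern hF, ← card_freePositions, zpow_natCast]
  push_cast
  rfl

/-- The excess of the moments is an abstract parameter `η`, to allow `η = 0` for empty patterns and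
small `n`. The normalized moments are below 1 by at most the defect of full rank and above 1 by at
most `η`. -/
theorem abs_symmCount_div_sub_le [Fintype 𝔽] {F : Fin n → Finset (Fin n)}
    (hF : ∀ i j, i ∈ F j ↔ j ∈ F i) (hodd : Odd (Fintype.card 𝔽) ∨ ∀ i, i ∉ F i)
    {k r L : ℕ} (hr : r ≤ n) (hk : n - r = k) (hJ : k + (L + 1) ≤ n) {η : ℝ} (hη0 : 0 ≤ η)
    (hη : ∀ j ≤ k + (L + 1), ∀ [Fintype {X : Matrix (Fin j) (Fin n) 𝔽 //
        LinearIndependent 𝔽 X.row}],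
      ∑ X : {X : Matrix (Fin j) (Fin n) 𝔽 // LinearIndependent 𝔽 X.row},
        (Nat.card (gramSpace F X.1) : ℝ) ≤
      Fintype.card {X : Matrix (Fin j) (Fin n) 𝔽 // LinearIndependent 𝔽 X.row} +
        (Fintype.card 𝔽 : ℝ) ^ (j * n) * η) {ε : ℝ}
    (hε : ε = 2 * (Fintype.card 𝔽 : ℝ) ^ (k + (L + 1)) / (Fintype.card 𝔽 : ℝ) ^ (n + 1) + η) :
    |(symmCount 𝔽 F r : ℝ) / (Fintype.card 𝔽 : ℝ) ^ freeEntries F -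
        symLimitMass (Fintype.card 𝔽) k| ≤
      8 * ε + 4 * (1 + ε) * (Fintype.card 𝔽 : ℝ)⁻¹ ^ (L + 1) +
        8 * (Fintype.card 𝔽 : ℝ)⁻¹ ^ (L + 1) := by
  classical
  have hq : 2 ≤ Fintype.card 𝔽 := Fintype.one_lt_card
  have hq' : (2 : ℝ) ≤ Fintype.card 𝔽 := by exact_mod_cast hq
  have hq0 : (0 : ℝ) < Fintype.card 𝔽 := by linarith
  let _ : Fintype (symmPattern 𝔽 F) := Fintype.ofFinite _
  rw [symmCount_eq F hr hk, ← card_symmPattern_zpow hF, Nat.card_eq_fintype_card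
    (α := symmPattern 𝔽 F)]
  let _ : ∀ j, Fintype {X : Matrix (Fin j) (Fin n) 𝔽 // LinearIndependent 𝔽 X.row} :=
    fun j => Fintype.ofFinite _
  refine abs_card_div_sub_symLimitMass_le (fun M : symmPattern 𝔽 F => n - M.1.rank) hq k L
    (fun j => (∑ X : {X : Matrix (Fin j) (Fin n) 𝔽 // LinearIndependent 𝔽 X.row},
          (Nat.card (gramSpace F X.1) : ℝ)) / (Fintype.card 𝔽 : ℝ) ^ (j * n))
    (fun j _ => sum_qFalling_corank hF hodd j) fun j hj => ?_
  have hpos : (0 : ℝ) < (Fintype.card 𝔽 : ℝ) ^ (j * n) := by positivity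
  have hcard : (Fintype.card {X : Matrix (Fin j) (Fin n) 𝔽 // LinearIndependent 𝔽 X.row} : ℝ) =
      qFalling (Fintype.card 𝔽) j ((Fintype.card 𝔽 : ℝ) ^ n) := by
    rw [← card_fullRank, Nat.card_eq_fintype_card]
  have hle : (Fintype.card {X : Matrix (Fin j) (Fin n) 𝔽 // LinearIndependent 𝔽 X.row} : ℝ) ≤
      (Fintype.card 𝔽 : ℝ) ^ (j * n) := by
    rw [← Nat.card_eq_fintype_card]
    have := Nat.card_le_card_of_injective _ (Subtype.val_injective
      (p := fun X : Matrix (Fin j) (Fin n) 𝔽 => LinearIndependent 𝔽 X.row))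
    rw [natCard_matrix] at this
    exact_mod_cast this
  have hge : (Fintype.card {X : Matrix (Fin j) (Fin n) 𝔽 // LinearIndependent 𝔽 X.row} : ℝ) ≤
      ∑ X : {X : Matrix (Fin j) (Fin n) 𝔽 // LinearIndependent 𝔽 X.row},
        (Nat.card (gramSpace F X.1) : ℝ) := by
    rw [← Finset.card_univ, ← nsmul_one, ← Finset.sum_const]
    refine Finset.sum_le_sum fun X _ => ?_
    exact_mod_cast Nat.card_pos (α := gramSpace F X.1)
  have h1 := one_sub_le_qFalling_div hq' (hj.trans hJ)
  rw [← hcard, le_div_iff₀ hpos] at h1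
  have h2 := hη j hj
  have h3 : 2 * (Fintype.card 𝔽 : ℝ) ^ j / (Fintype.card 𝔽 : ℝ) ^ (n + 1) ≤
      2 * (Fintype.card 𝔽 : ℝ) ^ (k + (L + 1)) / (Fintype.card 𝔽 : ℝ) ^ (n + 1) := by
    gcongr
    linarith
  have h4 : 0 ≤ 2 * (Fintype.card 𝔽 : ℝ) ^ (k + (L + 1)) / (Fintype.card 𝔽 : ℝ) ^ (n + 1) := by
    positivity
  have h5 : 1 - ε ≤ 1 - 2 * (Fintype.card 𝔽 : ℝ) ^ j / (Fintype.card 𝔽 : ℝ) ^ (n + 1) := by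
    linarith
  have h6 := mul_le_mul_of_nonneg_right h5 hpos.le
  rw [abs_le, sub_le_iff_le_add, div_le_iff₀ hpos, neg_le_sub_iff_le_add, ← sub_le_iff_le_add,
    le_div_iff₀ hpos]
  refine ⟨by linarith, ?_⟩
  have h7 : (Fintype.card 𝔽 : ℝ) ^ (j * n) * η ≤ (Fintype.card 𝔽 : ℝ) ^ (j * n) * ε :=
    mul_le_mul_of_nonneg_left (by linarith) hpos.le
  linarith

theorem sum_card_gramSpace_of_empty [Fintype 𝔽] {F : Fin n → Finset (Fin n)}
    (hF : ∀ i, F i = ∅) (j : ℕ)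
    [Fintype {X : Matrix (Fin j) (Fin n) 𝔽 // LinearIndependent 𝔽 X.row}] :
    ∑ X : {X : Matrix (Fin j) (Fin n) 𝔽 // LinearIndependent 𝔽 X.row},
        (Nat.card (gramSpace F X.1) : ℝ) =
      Fintype.card {X : Matrix (Fin j) (Fin n) 𝔽 // LinearIndependent 𝔽 X.row} := by
  have h : ∀ X : {X : Matrix (Fin j) (Fin n) 𝔽 // LinearIndependent 𝔽 X.row},
      Nat.card (gramSpace F X.1) = 1 := fun X => by
    have : gramSpace F X.1 = ⊥ := by
      rw [eq_bot_iff]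
      intro B hB
      rw [Submodule.mem_bot]
      ext a b
      exact apply_eq_zero_of_mem_gramSpace hB (by simp [hF])
    rw [this]
    simp
  simp [h]

theorem one_add_pow_sub_one_le {x A : ℝ} (hx : 0 ≤ x) (n : ℕ) (hA : n * x ≤ A) :
    (1 + x) ^ n - 1 ≤ n * x * Real.exp A := by
  have h1 : (1 + x) ^ n ≤ Real.exp (n * x) := by
    rw [Real.exp_nat_mul]
    exact pow_le_pow_left₀ (by linarith) (by linarith [Real.add_one_le_exp x]) n
  have h2 : Real.exp (n * x) - 1 ≤ n * x * Real.exp (n * x) := by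
    have h3 := Real.add_one_le_exp (-(n * x))
    have h4 : Real.exp (-(n * x)) * Real.exp (n * x) = 1 := by
      rw [← Real.exp_add, neg_add_cancel, Real.exp_zero]
    have h5 := Real.exp_pos (n * x)
    nlinarith
  have h6 : n * x * Real.exp (n * x) ≤ n * x * Real.exp A :=
    mul_le_mul_of_nonneg_left (Real.exp_le_exp.2 hA) (by positivity)
  linarith

theorem inv_pow_le_rpow {q : ℝ} (hq : 2 ≤ q) {m : ℕ} {y : ℝ} (h : y ≤ m) :
    q⁻¹ ^ m ≤ (1 / q) ^ y := by
  obtain ⟨hx0, hx⟩ := inv_nonneg_le_half hq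
  rw [one_div, ← Real.rpow_natCast]
  exact Real.rpow_le_rpow_of_exponent_ge hx0 (by linarith) h

theorem abs_symLimitMass_zero_sub_one_le {q : ℕ} (hq : 2 ≤ q) : |symLimitMass q 0 - 1| ≤ 4 := by
  have hq' : (2 : ℝ) ≤ q := by exact_mod_cast hq
  obtain ⟨hx0, hx⟩ := inv_nonneg_le_half hq'
  have h := abs_eulerSeries_sub_le hq' (z := -(q : ℝ)⁻¹)
    (by rw [abs_neg, abs_of_pos hx0]; exact hx) 1
  rw [abs_neg, abs_of_pos hx0, eulerSeries_neg_inv hq] at h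
  have e : symLimitMass q 0 = ∏' i : ℕ, (1 - ((q : ℝ) ^ (2 * i + 1))⁻¹) := by
    simp [symLimitMass]
  rw [e]
  simp only [Finset.sum_range_one, eulerCoeff_zero, pow_zero, mul_one, pow_one] at h
  linarith

/-- Factor by factor, the odd product dominates the full product, which is at least 1/4. This turns
an absolute error into a relative one. -/
theorem one_div_four_le_symLimitMass_zero {q : ℕ} (hq : 2 ≤ q) : 1 / 4 ≤ symLimitMass q 0 := by
  have hq' : (2 : ℝ) ≤ q := by exact_mod_cast hq
  obtain ⟨hx0, hx⟩ := inv_nonneg_le_half hq'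
  have e : symLimitMass q 0 = ∏' i : ℕ, (1 - ((q : ℝ) ^ (2 * i + 1))⁻¹) := by
    simp [symLimitMass]
  rw [e]
  refine ge_of_tendsto' (multipliable_symLimitMass q hq).tendsto_prod_tprod_nat fun N => ?_
  refine (one_div_four_le_prod hq' N).trans (Finset.prod_le_prod (fun i _ => ?_) fun i _ => ?_)
  · rw [sub_nonneg]
    exact pow_le_one₀ hx0.le (by linarith)
  · rw [← inv_pow, sub_le_sub_iff_left]
    exact pow_le_pow_of_le_one hx0.le (by linarith) (by omega)

/-- A constant for the exponentially small error in the rank distribution. -/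
noncomputable def rankErrorConst : ℝ := 36 + 12 * (160 * Real.exp 160)

theorem rankErrorConst_pos : 0 < rankErrorConst := by unfold rankErrorConst; positivity

theorem abs_symmCount_div_sub_le_rpow [Fintype 𝔽] {F : Fin n → Finset (Fin n)} {r : ℕ}
    (hF : IsSymmPattern (1 / 80) F) (hodd : Odd (Fintype.card 𝔽) ∨ ∀ i, i ∉ F i)
    (hr : (1 - 1 / 80) * (n : ℝ) ≤ r) (hrn : r ≤ n) :
    |(symmCount 𝔽 F r : ℝ) / (Fintype.card 𝔽 : ℝ) ^ freeEntries F -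
        symLimitMass (Fintype.card 𝔽) (n - r)| ≤
      rankErrorConst * (1 / (Fintype.card 𝔽 : ℝ)) ^ (1 / 160 * (n : ℝ)) := by
  unfold rankErrorConst
  set K₁ : ℝ := 160 * Real.exp 160 with hK₁
  have hK₁0 : 0 < K₁ := by positivity
  have hq : 2 ≤ Fintype.card 𝔽 := Fintype.one_lt_card
  have hq' : (2 : ℝ) ≤ Fintype.card 𝔽 := by exact_mod_cast hq
  obtain ⟨hx0, hx⟩ := inv_nonneg_le_half hq'
  have hq0 : (0 : ℝ) < Fintype.card 𝔽 := by linarith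
  have hk : 80 * (n - r) ≤ n := by
    have : (79 : ℝ) * n ≤ 80 * r := by linarith
    have : 79 * n ≤ 80 * r := by exact_mod_cast this
    omega
  have hf : ∀ i, 80 * (F i).card < n := fun i => by
    have h1 := hF.card_lt i
    have h2 : (80 : ℝ) * (F i).card < n := by linarith
    exact_mod_cast h2
  -- For `n < 80` the bound `80 * (F i).card < n` empties the pattern and the corank is 0. A single
  -- factor `1/q` then suffices, as the target exponent `n / 160` is below 1. For `n = 0` not even
  -- one moment beyond the zeroth is available, and the trivial bound is used.
  rcases lt_or_ge n 80 with hn | hn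
  · have hempty : ∀ i, F i = ∅ := fun i => Finset.card_eq_zero.1 (by have := hf i; omega)
    have hk0 : n - r = 0 := by omega
    rw [hk0]
    rcases Nat.eq_zero_or_pos n with h0 | h0
    · subst h0
      have h1 : (symmCount 𝔽 F r : ℝ) / (Fintype.card 𝔽 : ℝ) ^ freeEntries F ≤ 1 := by
        rw [symmCount_eq F hrn rfl, ← card_symmPattern_zpow hF.symm]
        refine div_le_one_of_le₀ ?_ (Nat.cast_nonneg _)
        exact_mod_cast Nat.card_le_card_of_injective _ Subtype.val_injective
      have h2 : 0 ≤ (symmCount 𝔽 F r : ℝ) / (Fintype.card 𝔽 : ℝ) ^ freeEntries F := by positivity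
      have h3 := abs_le.1 (abs_symLimitMass_zero_sub_one_le hq)
      rw [Nat.cast_zero, mul_zero, Real.rpow_zero, mul_one, abs_le]
      constructor <;> linarith [h3.1, h3.2]
    · have hmain := abs_symmCount_div_sub_le (𝔽 := 𝔽) (L := 0) hF.symm hodd hrn hk0
        (by omega) le_rfl (fun j _ => by
          intro
          rw [sum_card_gramSpace_of_empty hempty, mul_zero, add_zero]) rfl
      refine hmain.trans ?_
      have h1 : 2 * (Fintype.card 𝔽 : ℝ) ^ (0 + (0 + 1)) / (Fintype.card 𝔽 : ℝ) ^ (n + 1) ≤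
          2 * (Fintype.card 𝔽 : ℝ)⁻¹ := by
        rw [zero_add, zero_add, pow_one, pow_succ, mul_div_mul_right _ _ hq0.ne', div_eq_mul_inv,
          ← inv_pow]
        have := pow_le_pow_of_le_one hx0.le (by linarith) h0
        rw [Nat.succ_eq_add_one, zero_add, pow_one] at this
        linarith
      have h2 := inv_pow_le_rpow hq' (m := 1) (y := 1 / 160 * (n : ℝ)) (by
        have : (n : ℝ) < 80 := by exact_mod_cast hn
        push_cast; linarith)
      have h3 : 0 ≤ 2 * (Fintype.card 𝔽 : ℝ) ^ (0 + (0 + 1)) / (Fintype.card 𝔽 : ℝ) ^ (n + 1) := by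
        positivity
      set E := 2 * (Fintype.card 𝔽 : ℝ) ^ (0 + (0 + 1)) / (Fintype.card 𝔽 : ℝ) ^ (n + 1)
      rw [zero_add, pow_one] at *
      have h4 : E ≤ 1 := by linarith
      have h5 : (36 + 12 * K₁) * (Fintype.card 𝔽 : ℝ)⁻¹ ≤
          (36 + 12 * K₁) * (1 / (Fintype.card 𝔽 : ℝ)) ^ (1 / 160 * (n : ℝ)) :=
        mul_le_mul_of_nonneg_left h2 (by positivity)
      have h6 : E * (Fintype.card 𝔽 : ℝ)⁻¹ ≤ (Fintype.card 𝔽 : ℝ)⁻¹ :=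
        mul_le_of_le_one_left hx0.le h4
      have h7 : 0 < K₁ * (Fintype.card 𝔽 : ℝ)⁻¹ := mul_pos hK₁0 hx0
      linarith
  -- With `s = n / 80` rounded down, the corank and the sizes of the `F i` are at most `s`. Moments
  -- up to `j ≤ 3 * s` are used, and `h = 3 * s` meets `3 * j + 2 * h ≤ 15 * s ≤ n`.
  · obtain ⟨s, hs⟩ : ∃ s, s = n / 80 := ⟨_, rfl⟩
    have hs1 : 1 ≤ s := by omega
    have hks : n - r ≤ s := by omega
    have hL : 2 * s - 1 + 1 = 2 * s := by omega
    have hns : n ≤ 160 * s := by omega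
    set x : ℝ := (Fintype.card 𝔽 : ℝ)⁻¹ ^ s with hxdef
    have hxp : 0 < x := pow_pos hx0 s
    have hx1 : x ≤ 1 := pow_le_one₀ hx0.le (by linarith)
    have hnx : n * x ≤ 160 := by
      have h1 : (s : ℝ) ≤ 2 ^ s := by exact_mod_cast Nat.lt_two_pow_self.le
      have h2 : x ≤ (1 / 2) ^ s := pow_le_pow_left₀ hx0.le hx s
      have h3 : (n : ℝ) ≤ 160 * s := by exact_mod_cast hns
      calc n * x ≤ 160 * s * (1 / 2) ^ s := by gcongr
        _ ≤ 160 * 2 ^ s * (1 / 2) ^ s := by gcongr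
        _ = 160 := by rw [mul_assoc, ← mul_pow]; norm_num
    have hη : ∀ j ≤ n - r + (2 * s - 1 + 1), ∀ [Fintype {X : Matrix (Fin j) (Fin n) 𝔽 //
        LinearIndependent 𝔽 X.row}],
      ∑ X : {X : Matrix (Fin j) (Fin n) 𝔽 // LinearIndependent 𝔽 X.row},
        (Nat.card (gramSpace F X.1) : ℝ) ≤
      Fintype.card {X : Matrix (Fin j) (Fin n) 𝔽 // LinearIndependent 𝔽 X.row} +
        (Fintype.card 𝔽 : ℝ) ^ (j * n) * (K₁ * x) := by
      intro j hj _
      have h1 := sum_card_gramSpace_le (𝔽 := 𝔽) (F := F) (j := j) (f := s) (h := 3 * s)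
        (fun i => by have := hf i; omega) (by omega)
      -- The weight is `q ^ (-2 * s) = x * x`: one factor `x` absorbs `n`, the other remains as the
      -- error.
      have h2 : (Fintype.card 𝔽 : ℝ) ^ s * (1 / (Fintype.card 𝔽 : ℝ) ^ (3 * s)) = x * x := by
        rw [hxdef, ← pow_add, inv_pow, show 3 * s = s + (s + s) by ring, pow_add _ s (s + s)]
        field_simp
      rw [h2] at h1
      have h3 := one_add_pow_sub_one_le (x := x * x) (A := 160) (by positivity) n (by nlinarith)
      have h4 : n * (x * x) * Real.exp 160 ≤ K₁ * x := by
        have h5 : 0 ≤ x * Real.exp 160 := by positivity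
        calc n * (x * x) * Real.exp 160 = n * x * (x * Real.exp 160) := by ring
          _ ≤ 160 * (x * Real.exp 160) := mul_le_mul_of_nonneg_right hnx h5
          _ = K₁ * x := by rw [hK₁]; ring
      have h6 : (Fintype.card 𝔽 : ℝ) ^ (j * n) * ((1 + x * x) ^ n - 1) ≤
          (Fintype.card 𝔽 : ℝ) ^ (j * n) * (K₁ * x) :=
        mul_le_mul_of_nonneg_left (h3.trans h4) (by positivity)
      linarith
    have hmain := abs_symmCount_div_sub_le (𝔽 := 𝔽) (L := 2 * s - 1) hF.symm hodd hrn rfl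
      (by omega) (by positivity) hη rfl
    refine hmain.trans ?_
    rw [hL]
    have h1 : 2 * (Fintype.card 𝔽 : ℝ) ^ (n - r + 2 * s) / (Fintype.card 𝔽 : ℝ) ^ (n + 1) ≤
        2 * x := by
      rw [hxdef, inv_pow, div_le_iff₀ (by positivity), mul_assoc]
      refine mul_le_mul_of_nonneg_left ?_ (by norm_num)
      rw [← div_eq_inv_mul, le_div_iff₀ (by positivity), ← pow_add]
      exact pow_le_pow_right₀ (by linarith) (by omega)
    have h2 : (Fintype.card 𝔽 : ℝ)⁻¹ ^ (2 * s) ≤ x :=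
      pow_le_pow_of_le_one hx0.le (by linarith) (by omega)
    have h3 : x ≤ (1 / (Fintype.card 𝔽 : ℝ)) ^ (1 / 160 * (n : ℝ)) := by
      refine inv_pow_le_rpow hq' ?_
      have : (n : ℝ) ≤ 160 * s := by exact_mod_cast hns
      linarith
    have h0 : 0 ≤ 2 * (Fintype.card 𝔽 : ℝ) ^ (n - r + 2 * s) / (Fintype.card 𝔽 : ℝ) ^ (n + 1) := by
      positivity
    have h02 : 0 ≤ (Fintype.card 𝔽 : ℝ)⁻¹ ^ (2 * s) := by positivity
    set E := 2 * (Fintype.card 𝔽 : ℝ) ^ (n - r + 2 * s) / (Fintype.card 𝔽 : ℝ) ^ (n + 1)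
    -- With `ε ≤ (2 + K₁) * x`, the three error terms add up to at most `(16 + 8 * K₁) + (12 + 4 *
    -- K₁) + 8 = 36 + 12 * K₁` times `x`.
    have h4 : E + K₁ * x ≤ 2 + K₁ := by nlinarith
    have h5 : 4 * (1 + (E + K₁ * x)) * (Fintype.card 𝔽 : ℝ)⁻¹ ^ (2 * s) ≤ 4 * (3 + K₁) * x := by
      apply mul_le_mul _ h2 h02 (by positivity)
      linarith
    have h6 : (36 + 12 * K₁) * x ≤
        (36 + 12 * K₁) * (1 / (Fintype.card 𝔽 : ℝ)) ^ (1 / 160 * (n : ℝ)) :=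
      mul_le_mul_of_nonneg_left h3 (by positivity)
    nlinarith

theorem abs_sub_le_of_abs_div_sub_le {N A Q E : ℝ} (hA : 0 < A) (h : |N / A - Q| ≤ E) :
    |N - A * Q| ≤ A * E := by
  have e : N - A * Q = A * (N / A - Q) := by field_simp
  rw [e, abs_mul, abs_of_pos hA]
  exact mul_le_mul_of_nonneg_left h hA.le

theorem freeEntries_singleton (n : ℕ) :
    freeEntries (fun i : Fin n => {i}) = (n.choose 2 : ℤ) := by
  have h : ∀ i : Fin n, ((({i} : Finset (Fin n)).filter fun j => i ≤ j).card : ℤ) = 1 := by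
    intro i
    rw [Finset.filter_singleton, if_pos le_rfl, Finset.card_singleton, Nat.cast_one]
  simp only [freeEntries, h]
  rw [Nat.choose_succ_succ' n 1]
  simp

theorem freeEntries_empty (n : ℕ) :
    freeEntries (fun _ : Fin n => ∅) = ((n + 1).choose 2 : ℤ) := by
  simp [freeEntries]

theorem abs_symmCount_sub_le_rpow [Fintype 𝔽] {F : Fin n → Finset (Fin n)} {r : ℕ}
    (hF : IsSymmPattern (1 / 80) F) (hodd : Odd (Fintype.card 𝔽) ∨ ∀ i, i ∉ F i)
    (hr : (1 - 1 / 80) * (n : ℝ) ≤ r) (hrn : r ≤ n) :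
    |(symmCount 𝔽 F r : ℝ) -
        (Fintype.card 𝔽 : ℝ) ^ freeEntries F * symLimitMass (Fintype.card 𝔽) (n - r)| ≤
      (Fintype.card 𝔽 : ℝ) ^ freeEntries F *
        (rankErrorConst * (1 / (Fintype.card 𝔽 : ℝ)) ^ (1 / 160 * (n : ℝ))) := by
  have hq0 : (0 : ℝ) < Fintype.card 𝔽 := by exact_mod_cast Fintype.card_pos
  exact abs_sub_le_of_abs_div_sub_le (zpow_pos hq0 _)
    (abs_symmCount_div_sub_le_rpow hF hodd hr hrn)

/-- Replacing `1/q` by `1/2` makes the threshold uniform in `q`. -/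
theorem exists_zeroDiagonal_threshold :
    ∃ N : ℕ, ∀ n ≥ N, rankErrorConst * ((1 / 2 : ℝ) ^ (1 / 320 : ℝ)) ^ n ≤ 1 / 8 := by
  have hlim : Filter.Tendsto (fun n : ℕ => rankErrorConst * ((1 / 2 : ℝ) ^ (1 / 320 : ℝ)) ^ n)
      Filter.atTop (nhds (rankErrorConst * 0)) :=
    (tendsto_pow_atTop_nhds_zero_of_lt_one (by positivity)
      (Real.rpow_lt_one (by norm_num) (by norm_num) (by norm_num))).const_mul _
  rw [mul_zero] at hlim
  obtain ⟨N, hN⟩ := Filter.eventually_atTop.1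
    (hlim.eventually (gt_mem_nhds (show (0 : ℝ) < 1 / 8 by norm_num)))
  exact ⟨N, fun n hn => (hN n hn).le⟩

end Main

/-! ### The theorem -/

theorem mainTheorem10 :
    (∃ α₀ : ℝ, 0 < α₀ ∧ ∀ α : ℝ, 0 < α → α < α₀ →
      ∃ C' c K : ℝ, 0 < C' ∧ 0 < c ∧ 0 < K ∧
        ∀ (𝔽 : Type*) [Field 𝔽] [Fintype 𝔽] (n : ℕ) (F : Fin n → Finset (Fin n)) (r : ℕ),
          IsSymmPattern α F →
          (Odd (Fintype.card 𝔽) ∨ ∀ i, i ∉ F i) →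
          (1 - α) * (n : ℝ) ≤ (r : ℝ) → r ≤ n →
          |(symmCount 𝔽 F r : ℝ) -
              (Fintype.card 𝔽 : ℝ) ^ freeEntries F * symLimitMass (Fintype.card 𝔽) (n - r)| ≤
            (Fintype.card 𝔽 : ℝ) ^ freeEntries F *
              (K * (C' / (Fintype.card 𝔽 : ℝ)) ^ (c * (n : ℝ)))) ∧
    (∃ (n₀ : ℕ) (c K : ℝ), 0 < c ∧ 0 < K ∧
      ∀ (𝔽 : Type*) [Field 𝔽] [Fintype 𝔽] (n : ℕ), Odd (Fintype.card 𝔽) → n₀ ≤ n →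
        |(symmCount 𝔽 (fun i : Fin n => {i}) n : ℝ) -
            (Fintype.card 𝔽 : ℝ) ^ n.choose 2 * symLimitMass (Fintype.card 𝔽) 0| ≤
          (Fintype.card 𝔽 : ℝ) ^ n.choose 2 *
            (K * (1 / (Fintype.card 𝔽 : ℝ)) ^ (c * (n : ℝ))) ∧
        |(symmCount 𝔽 (fun i : Fin n => {i}) n : ℝ) -
            (symmCount 𝔽 (fun _ : Fin (n - 1) => ∅) (n - 1) : ℝ)| ≤
          (symmCount 𝔽 (fun _ : Fin (n - 1) => ∅) (n - 1) : ℝ) *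
            (K * (1 / (Fintype.card 𝔽 : ℝ)) ^ (c * (n : ℝ)))) := by
  refine ⟨⟨1 / 80, by norm_num, fun α hα0 hα => ⟨1, 1 / 160, rankErrorConst, one_pos, by norm_num,
    rankErrorConst_pos, ?_⟩⟩, ?_⟩
  · intro 𝔽 _ _ n F r hF hodd hr hrn
    have hn : (0 : ℝ) ≤ n := Nat.cast_nonneg n
    refine abs_symmCount_sub_le_rpow ⟨fun i => (hF.card_lt i).trans_le ?_, hF.symm⟩ hodd
      (le_trans ?_ hr) hrn
    · exact mul_le_mul_of_nonneg_right hα.le hn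
    · exact mul_le_mul_of_nonneg_right (by linarith) hn
  · obtain ⟨N, hN⟩ := exists_zeroDiagonal_threshold
    -- Singletons satisfy the pattern condition once `n > 80`, which 82 ensures. Halving the
    -- exponent to `1 / 320` absorbs the shift to `n - 1`, and 16 is `2 * 8`: two errors, measured
    -- against a count that is at least `A / 8`.
    refine ⟨max N 82, 1 / 320, 16 * rankErrorConst, by norm_num,
      mul_pos (by norm_num) rankErrorConst_pos, ?_⟩
    intro 𝔽 _ _ n hodd hn
    have hK0 := rankErrorConst_pos
    have hnN : N ≤ n := (le_max_left _ _).trans hn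
    have hn82 : 82 ≤ n := (le_max_right _ _).trans hn
    have hn82' : (82 : ℝ) ≤ n := by exact_mod_cast hn82
    have hq : 2 ≤ Fintype.card 𝔽 := Fintype.one_lt_card
    have hq' : (2 : ℝ) ≤ Fintype.card 𝔽 := by exact_mod_cast hq
    have hq0 : (0 : ℝ) < Fintype.card 𝔽 := by linarith
    have hb0 : 0 < 1 / (Fintype.card 𝔽 : ℝ) := by positivity
    have hb1 : 1 / (Fintype.card 𝔽 : ℝ) ≤ 1 / 2 := one_div_le_one_div_of_le (by norm_num) hq'
    set δ := (1 / (Fintype.card 𝔽 : ℝ)) ^ (1 / 320 * (n : ℝ)) with hδ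
    have hδ0 : 0 < δ := Real.rpow_pos_of_pos hb0 _
    have hδN : rankErrorConst * δ ≤ 1 / 8 := by
      have h1 : δ ≤ ((1 / 2 : ℝ) ^ (1 / 320 : ℝ)) ^ n := by
        rw [← Real.rpow_mul_natCast (by norm_num)]
        exact Real.rpow_le_rpow hb0.le hb1 (by positivity)
      exact (mul_le_mul_of_nonneg_left h1 hK0.le).trans (hN n hnN)
    have h1 := abs_symmCount_sub_le_rpow (𝔽 := 𝔽) (F := fun i : Fin n => {i}) (r := n)
      ⟨fun i => by rw [Finset.card_singleton]; push_cast; linarith, fun i j => by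
        simp only [Finset.mem_singleton]; exact eq_comm⟩ (Or.inl hodd) (by linarith) le_rfl
    have h2 := abs_symmCount_sub_le_rpow (𝔽 := 𝔽) (F := fun _ : Fin (n - 1) => ∅) (r := n - 1)
      ⟨fun i => by
        rw [Finset.card_empty, Nat.cast_zero]
        have : (0 : ℝ) < (n - 1 : ℕ) := by exact_mod_cast (by omega : 0 < n - 1)
        positivity, fun i j => by simp⟩ (Or.inl hodd)
      (by
        have : (0 : ℝ) ≤ (n - 1 : ℕ) := Nat.cast_nonneg _
        linarith) le_rfl
    rw [freeEntries_singleton, zpow_natCast, Nat.sub_self] at h1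
    rw [freeEntries_empty, zpow_natCast, Nat.sub_self, Nat.sub_add_cancel (by omega)] at h2
    have hA : 0 < (Fintype.card 𝔽 : ℝ) ^ n.choose 2 := by positivity
    have e1 : (1 / (Fintype.card 𝔽 : ℝ)) ^ (1 / 160 * (n : ℝ)) ≤ δ :=
      Real.rpow_le_rpow_of_exponent_ge hb0 (by linarith) (by linarith)
    have e2 : (1 / (Fintype.card 𝔽 : ℝ)) ^ (1 / 160 * ((n - 1 : ℕ) : ℝ)) ≤ δ := by
      refine Real.rpow_le_rpow_of_exponent_ge hb0 (by linarith) ?_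
      rw [Nat.cast_sub (by omega), Nat.cast_one]
      linarith
    have h1' := h1.trans (mul_le_mul_of_nonneg_left (mul_le_mul_of_nonneg_left e1 hK0.le) hA.le)
    have h2' := h2.trans (mul_le_mul_of_nonneg_left (mul_le_mul_of_nonneg_left e2 hK0.le) hA.le)
    refine ⟨h1'.trans (mul_le_mul_of_nonneg_left ?_ hA.le), ?_⟩
    · have : 0 < rankErrorConst * δ := by positivity
      linarith
    · have hQ := one_div_four_le_symLimitMass_zero hq
      set A := (Fintype.card 𝔽 : ℝ) ^ n.choose 2
      set S := (symmCount 𝔽 (fun _ : Fin (n - 1) => ∅) (n - 1) : ℝ)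
      -- The main term is at least `A / 4`, and the threshold makes the error at most `A / 8`.
      have hS : A / 8 ≤ S := by
        have h3 := (abs_le.1 h2').1
        have h4 : A * (rankErrorConst * δ) ≤ A * (1 / 8) := mul_le_mul_of_nonneg_left hδN hA.le
        have h5 : A * (1 / 4) ≤ A * symLimitMass (Fintype.card 𝔽) 0 :=
          mul_le_mul_of_nonneg_left hQ hA.le
        linarith
      have h3 := abs_sub_le (symmCount 𝔽 (fun i : Fin n => {i}) n : ℝ)
        (A * symLimitMass (Fintype.card 𝔽) 0) S
      rw [abs_sub_comm (A * _) S] at h3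
      have h4 : A / 8 * (16 * (rankErrorConst * δ)) ≤ S * (16 * (rankErrorConst * δ)) :=
        mul_le_mul_of_nonneg_right hS (by positivity)
      linarith
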